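/- Let $\Sigma$ be a finite alphabet. For strings $x,y\in\Sigma^*$ let $x \stackrel{\rm max\text{-}sdi}{\leftarrow} y$ be the set of all strings $x_1uzvx_2$ such that $x=x_1uvx_2$, $y=uzv$, $u\neq\varepsilon$, $v\neq\varepsilon$, and there are no suffix $x_1'$ of $x_1$, prefix $x_2'$ of $x_2$ and $z'\in\Sigma^*$ with $x_1'x_2'\neq\varepsilon$ and $y=x_1'uz'vx_2'$. Let $x \stackrel{\rm min\text{-}sdi}{\leftarrow} y$ be the set of all strings $x_1uzvx_2$ such that $x=x_1uvx_2$, $y=uzv$, $u\neq\varepsilon$, $v\neq\varepsilon$, no proper nonempty suffix of $u$ is a prefix of $u$, and no proper nonempty prefix of $v$ is a suffix of $v$. For languages $L_1,L_2\subseteq\Sigma^*$ and either of these operations $\leftarrow$, let $L_1\leftarrow L_2=\bigcup_{x\in L_1,\,y\in L_2}(x\leftarrow y)$. Given a finite alphabet $\Sigma$, a regular language $R\subseteq\Sigma^*$ (specified by a nondeterministic finite automaton) and a finite language $F\subseteq\Sigma^*$ (specified by a list of its strings), it is decidable (i) whether $R \stackrel{\rm max\text{-}sdi}{\leftarrow}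 F\subseteq R$, and (ii) whether $R \stackrel{\rm min\text{-}sdi}{\leftarrow} F\subseteq R$. Moreover, each of (i) and (ii) is decided by an algorithm that, for every constant $c$, runs in time polynomial in the length of the input on those inputs in which the automaton is deterministic (every state has at most one successor under every letter) and every string of $F$ has length at most $c$; the polynomial may depend on $c$. -/

import Mathlib

/-- Maximal site-directed insertion of the string `y` into the string `x`. -/
def maxSDIWord {α : Type*} (x y : List α) : Language α :=
  {w | ∃ x₁ u z v x₂ : List α,
    w = x₁ ++ u ++ z ++ v ++ x₂ ∧ x = x₁ ++ u ++ v ++ x₂ ∧ y = u ++ z ++ v ∧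
    u ≠ [] ∧ v ≠ [] ∧
    ¬ ∃ x₁' x₂' z' : List α, x₁' <:+ x₁ ∧ x₂' <+: x₂ ∧ x₁' ++ x₂' ≠ [] ∧
      y = x₁' ++ u ++ z' ++ v ++ x₂'}

/-- Minimal site-directed insertion of the string `y` into the string `x`. -/
def minSDIWord {α : Type*} (x y : List α) : Language α :=
  {w | ∃ x₁ u z v x₂ : List α,
    w = x₁ ++ u ++ z ++ v ++ x₂ ∧ x = x₁ ++ u ++ v ++ x₂ ∧ y = u ++ z ++ v ∧
    u ≠ [] ∧ v ≠ [] ∧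
    (¬ ∃ s : List α, s ≠ [] ∧ s ≠ u ∧ s <:+ u ∧ s <+: u) ∧
    (¬ ∃ s : List α, s ≠ [] ∧ s ≠ v ∧ s <+: v ∧ s <:+ v)}

/-- Maximal site-directed insertion of languages. -/
def maxSDI {α : Type*} (L₁ L₂ : Language α) : Language α :=
  {w | ∃ x ∈ L₁, ∃ y ∈ L₂, w ∈ maxSDIWord x y}

/-- Minimal site-directed insertion of languages. -/
def minSDI {α : Type*} (L₁ L₂ : Language α) : Language α :=
  {w | ∃ x ∈ L₁, ∃ y ∈ L₂, w ∈ minSDIWord x y}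

/-- An input of the decision problems: a finite alphabet `Fin numLetters`, a nondeterministic
finite automaton over it with state set `Fin numStates`, and a finite list of strings. -/
structure SDIInput where
  numStates : ℕ
  numLetters : ℕ
  /-- `trans q a r` says whether `r` is one of the successors of `q` under the letter `a`. -/
  trans : Fin numStates → Fin numLetters → Fin numStates → Bool
  start : Fin numStates
  final : Fin numStates → Bool
  words : List (List (Fin numLetters))

namespace SDIInput

/-- The automaton of an input. -/
def toNFA (I : SDIInput) : NFA (Fin I.numLetters) (Fin I.numStates) where
  step q a := {r | I.trans q a r = true}
  start := {I.start}
  accept := {q | I.final q = true}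

/-- The regular language `R` of an input: the language that its automaton accepts. -/
def R (I : SDIInput) : Language (Fin I.numLetters) := I.toNFA.accepts

/-- The finite language `F` of an input. -/
def F (I : SDIInput) : Language (Fin I.numLetters) := {w | w ∈ I.words}

/-- The automaton is a DFA: every state has at most one successor under every letter. -/
def Deterministic (I : SDIInput) : Prop :=
  ∀ q a, (I.toNFA.step q a).Subsingleton

/-- Self-delimiting unary notation. It is used for numbers that are at most the number of states
or the number of letters only, and the tables of final states
and of transitions have at least that many bits anyway. -/
def unary (n : ℕ) : List Bool := List.replicate n true ++ [false]

/-- A string, letter by letter, each letter announced by `true`; closed by `false`. -/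
def encodeWord {k : ℕ} (w : List (Fin k)) : List Bool :=
  w.flatMap (fun a => true :: unary a) ++ [false]

/-- The input tape: the number of states, the number of letters, the initial state, the bits of
the set of final states, the bits of the transition table, and the strings of the finite language,
each of them announced by `true`, closed by `false`. -/
def encode (I : SDIInput) : List Bool :=
  unary I.numStates ++ unary I.numLetters ++ unary I.start ++
  (List.finRange I.numStates).map I.final ++
  (List.finRange I.numStates).flatMap (fun q =>
    (List.finRange I.numLetters).flatMap (fun a =>
      (List.finRange I.numStates).map (fun r => I.trans q a r))) ++
  I.words.flatMap (fun w => true :: encodeWord w) ++ [false]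

end SDIInput

open Classical in
/-- On input `I`, the multi-stack Turing machine `M` halts with the one-bit output that tells
whether `P I` holds. -/
def CorrectOn (M : Turing.TM2ComputableAux Bool Bool) (P : SDIInput → Prop) (I : SDIInput) : Prop :=
  Nonempty (Turing.TM2Outputs M.tm (I.encode.map M.inputAlphabet.symm)
    (some ((Computability.encodeBool (decide (P I))).map M.outputAlphabet.symm)))

open Classical in
/-- On input `I`, the multi-stack Turing machine `M` halts after at most `t` steps with the one-bit
output that tells whether `P I` holds. -/
def CorrectOnInTime (M : Turing.TM2ComputableAux Bool Bool) (P : SDIInput → Prop) (I : SDIInput)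
    (t : ℕ) : Prop :=
  Nonempty (Turing.TM2OutputsInTime M.tm (I.encode.map M.inputAlphabet.symm)
    (some ((Computability.encodeBool (decide (P I))).map M.outputAlphabet.symm)) t)

/-- There is one Turing machine that decides `P` on all inputs and that, for every bound `c`, runs
in polynomial time (in the length of the input tape; the polynomial may depend on `c`) on the inputs
whose automaton is deterministic and whose finite language has no string longer than `c`. -/
def DecidableAndPolyTimeOnBoundedDFA (P : SDIInput → Prop) : Prop :=
  ∃ M : Turing.TM2ComputableAux Bool Bool,
    (∀ I : SDIInput, CorrectOn M P I) ∧
    ∀ c : ℕ, ∃ p : Polynomial ℕ, ∀ I : SDIInput,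
      I.Deterministic → (∀ w ∈ I.F, w.length ≤ c) →
        CorrectOnInTime M P I (p.eval I.encode.length)

/-! ### Structured programs on four stacks of bits, and their compilation to multi-stack machines -/

namespace StackProgram

/-! A failure of closure is a string `u ++ z ++ v` of `F` with contexts `x₁`, `x₂` such that the
site is admissible, `x₁uvx₂` lies in `R` and `x₁uzvx₂` does not. Admissibility splits into a
condition on the left of the site and its mirror image on the right. For the minimal operation these
concern `u` and `v` alone. For the maximal one, a violation on both sides at once already gives a
violation on one side (`siteMax_and_iff`), and only the `z.length` letters of `x₁` and of `x₂` next
to the site matter (`siteMax_take`).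

A counterexample can therefore be guessed letter by letter with finite memory: the factorization, a
window of at most `z.length` letters, and the sets of states reached without and with the insertion.
This is a finite graph, and closure fails exactly if a bad vertex is reachable (`reachable_iff`,
`search_iff`). In general there may be exponentially many sets of states, which still gives
termination (`exists_finite_nodes`). If the automaton is deterministic, only the empty set and
singletons occur, and with strings of length at most `c` the number of vertices is polynomial
(`exists_poly_nodes`). The algorithm is the same in both cases; only the estimate of its running
time differs.

To obtain a Turing machine, structured programs on four stacks are compiled to a multi-stack
machine, with one step per loop test (`steps_of_exec`). Data are binary trees in prefix code. The
class `PT` of functions computed in polynomial time is closed under pairing, case distinction and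
folds with polynomially bounded results (`PT.foldl`), hence contains the functions that define the
graph. `exists_search_program` then bounds the search by a polynomial in the size of the data and of
any finite set containing the reachable vertices. -/

/-- The names of the four stacks. -/
inductive Stk
  | m | a | b | c
  deriving DecidableEq

instance : Fintype Stk where
  elems := {.m, .a, .b, .c}
  complete k := by cases k <;> simp

/-- The contents of the four stacks. -/
structure Store where
  m : List Bool
  a : List Bool
  b : List Bool
  c : List Bool

namespace Store

def get (s : Store) : Stk → List Bool
  | .m => s.m
  | .a => s.a
  | .b => s.b
  | .c => s.c

def set (s : Store) : Stk → List Bool → Store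
  | .m, l => { s with m := l }
  | .a, l => { s with a := l }
  | .b, l => { s with b := l }
  | .c, l => { s with c := l }

theorem get_set (s : Store) (k : Stk) (l : List Bool) :
    (s.set k l).get = Function.update s.get k l := by
  funext j
  cases k <;> cases j <;> rfl

theorem set_get (s : Store) (k : Stk) : s.set k (s.get k) = s := by
  cases k <;> rfl

end Store

/-- Structured programs. `pop k cn ct cf` pops `k` and branches on the result (nothing, `true` or
`false`). `loop k x ct cf` pops `k` repeatedly: it ends when nothing is there, runs `ct` and goes on
when `true` is found; when `false` is found it runs `cf` and goes on if `x` and ends otherwise. -/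
inductive Cmd
  | skip
  | push (k : Stk) (b : Bool)
  | seq (c d : Cmd)
  | pop (k : Stk) (cn ct cf : Cmd)
  | loop (k : Stk) (x : Bool) (ct cf : Cmd)

/-- `Exec c s t s'`: the program `c` takes the store `s` to `s'` with `t` loop tests. -/
inductive Exec : Cmd → Store → ℕ → Store → Prop
  | skip (s : Store) : Exec .skip s 0 s
  | push (k : Stk) (b : Bool) (s : Store) : Exec (.push k b) s 0 (s.set k (b :: s.get k))
  | seq {c d : Cmd} {s s' s'' : Store} {t t' : ℕ} :
      Exec c s t s' → Exec d s' t' s'' → Exec (.seq c d) s (t + t') s''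
  | pop_none {k : Stk} {cn ct cf : Cmd} {s s' : Store} {t : ℕ} :
      s.get k = [] → Exec cn s t s' → Exec (.pop k cn ct cf) s t s'
  | pop_true {k : Stk} {cn ct cf : Cmd} {s s' : Store} {t : ℕ} {l : List Bool} :
      s.get k = true :: l → Exec ct (s.set k l) t s' → Exec (.pop k cn ct cf) s t s'
  | pop_false {k : Stk} {cn ct cf : Cmd} {s s' : Store} {t : ℕ} {l : List Bool} :
      s.get k = false :: l → Exec cf (s.set k l) t s' → Exec (.pop k cn ct cf) s t s'
  | loop_none {k : Stk} {x : Bool} {ct cf : Cmd} {s : Store} :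
      s.get k = [] → Exec (.loop k x ct cf) s 1 s
  | loop_true {k : Stk} {x : Bool} {ct cf : Cmd} {s s' s'' : Store} {t t' : ℕ} {l : List Bool} :
      s.get k = true :: l → Exec ct (s.set k l) t s' → Exec (.loop k x ct cf) s' t' s'' →
      Exec (.loop k x ct cf) s (t + t' + 1) s''
  | loop_false {k : Stk} {ct cf : Cmd} {s s' s'' : Store} {t t' : ℕ} {l : List Bool} :
      s.get k = false :: l → Exec cf (s.set k l) t s' → Exec (.loop k true ct cf) s' t' s'' →
      Exec (.loop k true ct cf) s (t + t' + 1) s''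
  | loop_exit {k : Stk} {ct cf : Cmd} {s s' : Store} {t : ℕ} {l : List Bool} :
      s.get k = false :: l → Exec cf (s.set k l) t s' →
      Exec (.loop k false ct cf) s (t + 1) s'

namespace Cmd

/-- The jump labels of a program: one for every loop. -/
def Lab : Cmd → Type
  | skip => Empty
  | push _ _ => Empty
  | seq c d => Lab c ⊕ Lab d
  | pop _ cn ct cf => Lab cn ⊕ (Lab ct ⊕ Lab cf)
  | loop _ _ ct cf => Option (Lab ct ⊕ Lab cf)

instance Lab.fintype : (c : Cmd) → Fintype (Lab c)
  | skip => inferInstanceAs (Fintype Empty)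
  | push _ _ => inferInstanceAs (Fintype Empty)
  | seq c d =>
    letI := Lab.fintype c
    letI := Lab.fintype d
    inferInstanceAs (Fintype (Lab c ⊕ Lab d))
  | pop _ cn ct cf =>
    letI := Lab.fintype cn
    letI := Lab.fintype ct
    letI := Lab.fintype cf
    inferInstanceAs (Fintype (Lab cn ⊕ (Lab ct ⊕ Lab cf)))
  | loop _ _ ct cf =>
    letI := Lab.fintype ct
    letI := Lab.fintype cf
    inferInstanceAs (Fintype (Option (Lab ct ⊕ Lab cf)))

/-- Statements of the target machine; its internal state is the result of the last `pop`. -/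
abbrev MStmt (Λ : Type) : Type := Turing.TM2.Stmt (fun _ : Stk => Bool) Λ (Option Bool)

/-- Pop the stack `k` and branch on the result. -/
def popBranch {Λ : Type} (k : Stk) (qn qt qf : MStmt Λ) : MStmt Λ :=
  .pop k (fun _ o => o) (.branch (fun v => v == none) qn (.branch (fun v => v == some true) qt qf))

/-- The statement that starts the program and goes on with `q` afterwards. -/
def entry {Λ : Type} : (c : Cmd) → (Lab c → Λ) → MStmt Λ → MStmt Λ
  | skip, _, q => q
  | push k b, _, q => .push k (fun _ => b) q
  | seq c d, i, q => entry c (fun l => i (.inl l)) (entry d (fun l => i (.inr l)) q)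
  | pop k cn ct cf, i, q =>
    popBranch k (entry cn (fun l => i (.inl l)) q) (entry ct (fun l => i (.inr (.inl l))) q)
      (entry cf (fun l => i (.inr (.inr l))) q)
  | loop _ _ _ _, i, _ => .goto fun _ => i none

/-- The statements at the labels of the program, when it is followed by `q`. -/
def code {Λ : Type} : (c : Cmd) → (Lab c → Λ) → MStmt Λ → Lab c → MStmt Λ
  | skip, _, _, l => nomatch l
  | push _ _, _, _, l => nomatch l
  | seq c d, i, q, l =>
    match l with
    | .inl l => code c (fun l => i (.inl l)) (entry d (fun l => i (.inr l)) q) l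
    | .inr l => code d (fun l => i (.inr l)) q l
  | pop _ cn ct cf, i, q, l =>
    match l with
    | .inl l => code cn (fun l => i (.inl l)) q l
    | .inr (.inl l) => code ct (fun l => i (.inr (.inl l))) q l
    | .inr (.inr l) => code cf (fun l => i (.inr (.inr l))) q l
  | loop k x ct cf, i, q, l =>
    match l with
    | none =>
      popBranch k q (entry ct (fun l => i (some (.inl l))) (.goto fun _ => i none))
        (entry cf (fun l => i (some (.inr l))) (bif x then .goto fun _ => i none else q))
    | some (.inl l) => code ct (fun l => i (some (.inl l))) (.goto fun _ => i none) l
    | some (.inr l) =>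
      code cf (fun l => i (some (.inr l))) (bif x then .goto fun _ => i none else q) l

/-- `t` steps of a machine take one configuration to another. -/
def Steps {Λ : Type} (M : Λ → MStmt Λ) (t : ℕ)
    (x y : Turing.TM2.Cfg (fun _ : Stk => Bool) Λ (Option Bool)) : Prop :=
  (flip bind (Turing.TM2.step M))^[t] (some x) = some y

theorem Steps.trans {Λ : Type} {M : Λ → MStmt Λ} {t t' : ℕ}
    {x y z : Turing.TM2.Cfg (fun _ : Stk => Bool) Λ (Option Bool)}
    (h : Steps M t x y) (h' : Steps M t' y z) : Steps M (t + t') x z := by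
  unfold Steps at *
  rw [add_comm, Function.iterate_add_apply, h, h']

theorem Steps.one {Λ : Type} (M : Λ → MStmt Λ) (l : Λ) (v : Option Bool)
    (S : Stk → List Bool) : Steps M 1 ⟨some l, v, S⟩ (Turing.TM2.stepAux (M l) v S) := rfl

theorem stepAux_popBranch_none {Λ : Type} {k : Stk} {qn qt qf : MStmt Λ} {v : Option Bool}
    {s : Store} (h : s.get k = []) :
    Turing.TM2.stepAux (popBranch k qn qt qf) v s.get = Turing.TM2.stepAux qn none s.get := by
  have e : Function.update s.get k [] = s.get := by rw [← h, Function.update_eq_self]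
  simp [popBranch, h, e]

theorem stepAux_popBranch_true {Λ : Type} {k : Stk} {qn qt qf : MStmt Λ} {v : Option Bool}
    {s : Store} {l : List Bool} (h : s.get k = true :: l) :
    Turing.TM2.stepAux (popBranch k qn qt qf) v s.get =
      Turing.TM2.stepAux qt (some true) (s.set k l).get := by
  simp [popBranch, h, Store.get_set]

theorem stepAux_popBranch_false {Λ : Type} {k : Stk} {qn qt qf : MStmt Λ} {v : Option Bool}
    {s : Store} {l : List Bool} (h : s.get k = false :: l) :
    Turing.TM2.stepAux (popBranch k qn qt qf) v s.get =
      Turing.TM2.stepAux qf (some false) (s.set k l).get := by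
  simp [popBranch, h, Store.get_set]

/-- `stepAux` runs straight-line code up to the next jump within a single machine step, so only the
arrival at a loop label costs a step. The continuation `q` is arbitrary because the continuation of
a loop body is the jump back to the label of the loop. -/
theorem steps_of_exec {Λ : Type} (M : Λ → MStmt Λ) {c : Cmd} {s s' : Store} {t : ℕ}
    (h : Exec c s t s') (i : Lab c → Λ) (q : MStmt Λ) (hM : ∀ l, M (i l) = code c i q l)
    (v : Option Bool) : ∃ v', Steps M t (Turing.TM2.stepAux (entry c i q) v s.get)
      (Turing.TM2.stepAux q v' s'.get) := by
  induction h generalizing q v with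
  | skip s => exact ⟨v, rfl⟩
  | push k b s =>
    refine ⟨v, ?_⟩
    rw [Store.get_set]
    rfl
  | seq _ _ ih ih' =>
    obtain ⟨v', h⟩ := ih (fun l => i (.inl l)) _ (fun l => hM (.inl l)) v
    obtain ⟨v'', h'⟩ := ih' (fun l => i (.inr l)) q (fun l => hM (.inr l)) v'
    exact ⟨v'', h.trans h'⟩
  | pop_none hk _ ih =>
    obtain ⟨v', h⟩ := ih (fun l => i (.inl l)) q (fun l => hM (.inl l)) none
    exact ⟨v', by rwa [entry, stepAux_popBranch_none hk]⟩
  | pop_true hk _ ih =>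
    obtain ⟨v', h⟩ := ih (fun l => i (.inr (.inl l))) q (fun l => hM (.inr (.inl l))) (some true)
    exact ⟨v', by rwa [entry, stepAux_popBranch_true hk]⟩
  | pop_false hk _ ih =>
    obtain ⟨v', h⟩ := ih (fun l => i (.inr (.inr l))) q (fun l => hM (.inr (.inr l))) (some false)
    exact ⟨v', by rwa [entry, stepAux_popBranch_false hk]⟩
  | @loop_none k x ct cf s hk =>
    have h := Steps.one M (i none) v s.get
    rw [hM none, code, stepAux_popBranch_none hk] at h
    exact ⟨none, h⟩
  | @loop_true k x ct cf s _ _ _ _ _ hk _ _ ih ih' =>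
    have h := Steps.one M (i none) v s.get
    rw [hM none, code, stepAux_popBranch_true hk] at h
    obtain ⟨v', h'⟩ := ih (fun l => i (some (.inl l))) _ (fun l => hM (some (.inl l))) (some true)
    obtain ⟨v'', h''⟩ := ih' i q hM v'
    refine ⟨v'', ?_⟩
    rw [add_comm]
    exact h.trans (h'.trans h'')
  | @loop_false k ct cf s _ _ _ _ _ hk _ _ ih ih' =>
    have h := Steps.one M (i none) v s.get
    rw [hM none, code, stepAux_popBranch_false hk] at h
    obtain ⟨v', h'⟩ := ih (fun l => i (some (.inr l))) _ (fun l => hM (some (.inr l))) (some false)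
    obtain ⟨v'', h''⟩ := ih' i q hM v'
    refine ⟨v'', ?_⟩
    rw [add_comm]
    exact h.trans (h'.trans h'')
  | @loop_exit k ct cf s _ _ _ hk _ ih =>
    have h := Steps.one M (i none) v s.get
    rw [hM none, code, stepAux_popBranch_false hk] at h
    obtain ⟨v', h'⟩ := ih (fun l => i (some (.inr l))) _ (fun l => hM (some (.inr l))) (some false)
    refine ⟨v', ?_⟩
    rw [add_comm]
    exact h.trans h'

/-- The machine of a program: input on the stack `a`, output on the stack `m`. -/
def machine (c : Cmd) : Turing.FinTM2 where
  K := Stk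
  k₀ := .a
  k₁ := .m
  Γ _ := Bool
  Λ := Option (Lab c)
  main := none
  σ := Option Bool
  initialState := none
  m
    -- `none` is the extra label of the start. The final `load` restores the initial internal state,
    -- as the halting configuration `haltList` requires.
    | none => entry c some (.load (fun _ => none) .halt)
    | some l => code c some (.load (fun _ => none) .halt) l

/-- The machine of a program with its alphabets. -/
def toComputableAux (c : Cmd) : Turing.TM2ComputableAux Bool Bool where
  tm := machine c
  inputAlphabet := Equiv.refl Bool
  outputAlphabet := Equiv.refl Bool

theorem initList_machine (c : Cmd) (l : List Bool) :
    Turing.initList (machine c) l = ⟨some none, none, (⟨[], l, [], []⟩ : Store).get⟩ := by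
  unfold Turing.initList
  congr 1
  funext k
  cases k <;> rfl

theorem haltList_machine (c : Cmd) (l : List Bool) :
    Turing.haltList (machine c) l = ⟨none, none, (⟨l, [], [], []⟩ : Store).get⟩ := by
  unfold Turing.haltList
  congr 1
  funext k
  cases k <;> rfl

theorem outputsInTime_of_exec {c : Cmd} {l l' : List Bool} {t n : ℕ}
    (h : Exec c ⟨[], l, [], []⟩ t ⟨l', [], [], []⟩) (hn : t + 1 ≤ n) :
    Nonempty (Turing.TM2OutputsInTime (machine c) l (some l') n) := by
  obtain ⟨v', h'⟩ := steps_of_exec (machine c).m h some (.load (fun _ => none) .halt)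
    (fun _ => rfl) none
  -- The additional step is the one at the main label, which enters the program.
  refine ⟨⟨⟨1 + t, ?_⟩, by simpa only [add_comm 1 t] using hn⟩⟩
  rw [initList_machine]
  exact Eq.trans ((Steps.one (machine c).m none none _).trans h')
    (congrArg some (haltList_machine c l').symm)

end Cmd

/-! ### Binary trees in prefix code on the main stack -/

/-- Binary trees, the universal data type. -/
inductive Bin
  | nil
  | node (x y : Bin)

namespace Bin

/-- The prefix code of a tree. -/
def code : Bin → List Bool
  | nil => [false]
  | node x y => true :: (code x ++ code y)

/-- The size of a tree is the length of its code. -/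
def size (x : Bin) : ℕ := x.code.length

@[simp] theorem size_nil : nil.size = 1 := rfl

@[simp] theorem size_node (x y : Bin) : (node x y).size = x.size + y.size + 1 := by
  simp [size, code]

theorem size_pos (x : Bin) : 0 < x.size := by
  cases x <;> simp

/-- The code is self-delimiting. This is what allows programs to work on the top tree of a stack
with anything below it. -/
theorem code_append_inj {x y : Bin} {r s : List Bool} (h : x.code ++ r = y.code ++ s) :
    x = y ∧ r = s := by
  induction x generalizing y r s with
  | nil =>
    cases y with
    | nil => simpa [code] using h
    | node _ _ => simp [code] at h
  | node a b iha ihb =>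
    cases y with
    | nil => simp [code] at h
    | node c d =>
      simp only [code, List.cons_append, List.append_assoc, List.cons.injEq, true_and] at h
      obtain ⟨rfl, h'⟩ := iha h
      obtain ⟨rfl, h''⟩ := ihb h'
      exact ⟨rfl, h''⟩

theorem code_injective : Function.Injective code := fun x y h =>
  (code_append_inj (r := []) (s := []) (by simpa using h)).1

end Bin

/-- `Runs c s n s'`: the program `c` takes the store `s` to `s'` with at most `n` loop tests. -/
def Runs (c : Cmd) (s : Store) (n : ℕ) (s' : Store) : Prop := ∃ t ≤ n, Exec c s t s'

namespace Runs

theorem mono {c : Cmd} {s s' : Store} {n n' : ℕ} (h : Runs c s n s') (hn : n ≤ n') :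
    Runs c s n' s' :=
  let ⟨t, ht, h⟩ := h
  ⟨t, ht.trans hn, h⟩

theorem skip (s : Store) : Runs .skip s 0 s := ⟨0, le_rfl, .skip s⟩

theorem push (k : Stk) (b : Bool) (s : Store) : Runs (.push k b) s 0 (s.set k (b :: s.get k)) :=
  ⟨0, le_rfl, .push k b s⟩

theorem seq {c d : Cmd} {s s' s'' : Store} {n n' : ℕ} (h : Runs c s n s')
    (h' : Runs d s' n' s'') : Runs (.seq c d) s (n + n') s'' :=
  let ⟨t, ht, h⟩ := h
  let ⟨t', ht', h'⟩ := h'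
  ⟨t + t', add_le_add ht ht', .seq h h'⟩

theorem pop_none {k : Stk} {cn ct cf : Cmd} {s s' : Store} {n : ℕ} (hk : s.get k = [])
    (h : Runs cn s n s') : Runs (.pop k cn ct cf) s n s' :=
  let ⟨t, ht, h⟩ := h
  ⟨t, ht, .pop_none hk h⟩

theorem pop_true {k : Stk} {cn ct cf : Cmd} {s s' : Store} {n : ℕ} (l : List Bool)
    (hk : s.get k = true :: l) (h : Runs ct (s.set k l) n s') : Runs (.pop k cn ct cf) s n s' :=
  let ⟨t, ht, h⟩ := h
  ⟨t, ht, .pop_true hk h⟩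

theorem pop_false {k : Stk} {cn ct cf : Cmd} {s s' : Store} {n : ℕ} (l : List Bool)
    (hk : s.get k = false :: l) (h : Runs cf (s.set k l) n s') : Runs (.pop k cn ct cf) s n s' :=
  let ⟨t, ht, h⟩ := h
  ⟨t, ht, .pop_false hk h⟩

theorem loop_none {k : Stk} {x : Bool} {ct cf : Cmd} {s : Store} (hk : s.get k = []) :
    Runs (.loop k x ct cf) s 1 s :=
  ⟨1, le_rfl, .loop_none hk⟩

theorem loop_true {k : Stk} {x : Bool} {ct cf : Cmd} {s s' s'' : Store} {n n' : ℕ}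
    (l : List Bool) (hk : s.get k = true :: l) (h : Runs ct (s.set k l) n s')
    (h' : Runs (.loop k x ct cf) s' n' s'') : Runs (.loop k x ct cf) s (n + n' + 1) s'' :=
  let ⟨t, ht, h⟩ := h
  let ⟨t', ht', h'⟩ := h'
  ⟨t + t' + 1, by omega, .loop_true hk h h'⟩

theorem loop_false {k : Stk} {ct cf : Cmd} {s s' s'' : Store} {n n' : ℕ}
    (l : List Bool) (hk : s.get k = false :: l) (h : Runs cf (s.set k l) n s')
    (h' : Runs (.loop k true ct cf) s' n' s'') : Runs (.loop k true ct cf) s (n + n' + 1) s'' :=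
  let ⟨t, ht, h⟩ := h
  let ⟨t', ht', h'⟩ := h'
  ⟨t + t' + 1, by omega, .loop_false hk h h'⟩

theorem loop_exit {k : Stk} {ct cf : Cmd} {s s' : Store} {n : ℕ}
    (l : List Bool) (hk : s.get k = false :: l) (h : Runs cf (s.set k l) n s') :
    Runs (.loop k false ct cf) s (n + 1) s' :=
  let ⟨t, ht, h⟩ := h
  ⟨t + 1, by omega, .loop_exit hk h⟩

end Runs

/-! ### Moving, copying and comparing trees -/

namespace Cmd

/-- Move the stack `k` to the stack `j`, in reverse order. -/
def transfer (k j : Stk) : Cmd := loop k true (push j true) (push j false)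

theorem runs_transfer {k j : Stk} (hkj : k ≠ j) (s : Store) :
    Runs (transfer k j) s ((s.get k).length + 1)
      ((s.set k []).set j ((s.get k).reverse ++ s.get j)) := by
  generalize hl : s.get k = l
  induction l generalizing s with
  | nil =>
    have h : (s.set k []).set j ([].reverse ++ s.get j) = s := by
      rw [← hl, Store.set_get, hl]
      exact Store.set_get s j
    rw [h]
    exact .loop_none hl
  | cons b l ih =>
    have h := ih ((s.set k l).set j (b :: s.get j))
      (by rw [Store.get_set, Function.update_of_ne hkj, Store.get_set, Function.update_self])
    have e : (((s.set k l).set j (b :: s.get j)).set k []).set j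
        (l.reverse ++ ((s.set k l).set j (b :: s.get j)).get j) =
        (s.set k []).set j ((b :: l).reverse ++ s.get j) := by
      rw [Store.get_set, Function.update_self, List.reverse_cons, List.append_assoc]
      cases k <;> cases j <;> first | exact absurd rfl hkj | rfl
    rw [e] at h
    have e' : s.get j = (s.set k l).get j := by
      rw [Store.get_set, Function.update_of_ne hkj.symm]
    rw [e'] at h ⊢
    refine Runs.mono (n := 0 + (l.length + 1) + 1) ?_ (by simp)
    cases b
    · exact .loop_false l hl (.push _ _ _) h
    · exact .loop_true l hl (.push _ _ _) h

/-- The loop of `take`; the stack `c` holds one `true` for every tree that remains to be moved. -/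
def takeLoop : Cmd :=
  loop .c false (pop .m skip (seq (push .a true) (seq (push .c true) (push .c true)))
    (push .a false)) skip

/-- Move the top tree of `m` to the stack `a`, in reverse order. -/
def take : Cmd := seq (push .c true) takeLoop

/-- A mark on `c` is an obligation to move one tree: a leaf discharges it, a node exchanges it for
two. The run that follows is a hypothesis, so that the two subtrees of a node can be chained; each
bit of `x` costs one test. -/
theorem runs_takeLoop (x : Bin) (r a b c : List Bool) (n : ℕ) (s : Store)
    (h : Runs takeLoop ⟨r, x.code.reverse ++ a, b, c⟩ n s) :
    Runs takeLoop ⟨x.code ++ r, a, b, true :: c⟩ (n + x.size) s := by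
  induction x generalizing r a b c n with
  | nil =>
    refine Runs.mono (n := 0 + n + 1) ?_ (by simp)
    exact .loop_true c rfl (.pop_false r rfl (.push _ _ _)) h
  | node x y ihx ihy =>
    have h1 := ihy r (x.code.reverse ++ true :: a) b c n (by simpa [Bin.code] using h)
    have h2 := ihx (y.code ++ r) (true :: a) b (true :: c) _ h1
    refine Runs.mono (n := (0 + (0 + 0)) + (n + y.size + x.size) + 1) ?_ (by simp; omega)
    refine .loop_true c rfl (.pop_true (x.code ++ (y.code ++ r)) (by simp [Store.get, Store.set, Bin.code])
      (.seq (.push _ _ _) (.seq (.push _ _ _) (.push _ _ _)))) h2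

theorem runs_take (x : Bin) (r a b : List Bool) :
    Runs take ⟨x.code ++ r, a, b, []⟩ (x.size + 1) ⟨r, x.code.reverse ++ a, b, []⟩ := by
  refine Runs.mono (n := 0 + (1 + x.size)) ?_ (by omega)
  exact .seq (.push _ _ _) (runs_takeLoop x r a b [] 1 _ (.loop_none rfl))

/-- The top tree of `m` is removed. -/
def drop : Cmd := seq take (loop .a true skip skip)

theorem runs_clear (m a b c : List Bool) :
    Runs (loop .a true skip skip) ⟨m, a, b, c⟩ (a.length + 1) ⟨m, [], b, c⟩ := by
  induction a with
  | nil => exact .loop_none rfl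
  | cons x a ih =>
    refine Runs.mono (n := 0 + (a.length + 1) + 1) ?_ (by simp)
    cases x
    · exact .loop_false a rfl (.skip _) ih
    · exact .loop_true a rfl (.skip _) ih

theorem runs_drop (x : Bin) (r : List Bool) :
    Runs drop ⟨x.code ++ r, [], [], []⟩ (2 * x.size + 2) ⟨r, [], [], []⟩ := by
  refine Runs.mono (.seq (runs_take x r [] []) (runs_clear _ _ _ _)) ?_
  simp [Bin.size]
  omega

/-- Exchange the two top trees of `m`. -/
def swap : Cmd :=
  seq take (seq (transfer .a .b) (seq take (seq (transfer .b .c)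
    (seq (transfer .c .m) (transfer .a .m)))))

/-- Every move reverses a tree. `x` waits on `b` while `take` counts on `c`, and then goes through
`c` so that it has been reversed an even number of times on arrival. -/
theorem runs_swap (x y : Bin) (r : List Bool) :
    Runs swap ⟨x.code ++ (y.code ++ r), [], [], []⟩ (4 * x.size + 2 * y.size + 6)
      ⟨y.code ++ (x.code ++ r), [], [], []⟩ := by
  refine Runs.mono (.seq (runs_take x _ [] []) (.seq (runs_transfer (by decide) _)
    (.seq (n := y.size + 1) (s' := ⟨r, y.code.reverse, x.code, []⟩) ?_ (.seq (runs_transfer (by decide) _)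
    (.seq (runs_transfer (by decide) _)
    (n' := y.size + 1) (s'' := ⟨y.code ++ (x.code ++ r), [], [], []⟩) ?_))))) ?_
  · simpa [Store.get, Store.set] using runs_take y r [] x.code
  · simpa [Store.get, Store.set, Bin.size] using
      runs_transfer (k := .a) (j := .m) (by decide) ⟨x.code ++ r, y.code.reverse, [], []⟩
  · simp [Store.get, Store.set, Bin.size]
    omega

/-- Duplicate the top tree of `m`. -/
def dup : Cmd :=
  seq take (seq (loop .a true (seq (push .m true) (push .b true))
    (seq (push .m false) (push .b false))) (seq (transfer .b .a) (transfer .a .m)))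

theorem runs_dupLoop (m a b c : List Bool) :
    Runs (loop .a true (seq (push .m true) (push .b true)) (seq (push .m false) (push .b false)))
      ⟨m, a, b, c⟩ (a.length + 1) ⟨a.reverse ++ m, [], a.reverse ++ b, c⟩ := by
  induction a generalizing m b with
  | nil => exact .loop_none rfl
  | cons x a ih =>
    refine Runs.mono (n := (0 + 0) + (a.length + 1) + 1) ?_ (by simp)
    have h := ih (x :: m) (x :: b)
    simp only [List.reverse_cons, List.append_assoc, List.singleton_append]
    cases x
    · exact .loop_false a rfl (.seq (.push _ _ _) (.push _ _ _)) h
    · exact .loop_true a rfl (.seq (.push _ _ _) (.push _ _ _)) h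

theorem runs_dup (x : Bin) (r : List Bool) :
    Runs dup ⟨x.code ++ r, [], [], []⟩ (4 * x.size + 4) ⟨x.code ++ (x.code ++ r), [], [], []⟩ := by
  refine Runs.mono (.seq (runs_take x _ [] []) (.seq (runs_dupLoop _ _ _ _)
    (.seq (runs_transfer (by decide) _)
    (n' := x.size + 1) (s'' := ⟨x.code ++ (x.code ++ r), [], [], []⟩) ?_))) ?_
  · simpa [Store.get, Store.set, Bin.size] using
      runs_transfer (k := .a) (j := .m) (by decide) ⟨x.code ++ r, x.code.reverse, [], []⟩
  · simp [Store.get, Bin.size]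
    omega

/-- Push the bits of a list on the main stack, the head of the list last. -/
def pushes : List Bool → Cmd
  | [] => skip
  | b :: l => seq (pushes l) (push .m b)

theorem runs_pushes (l m a b c : List Bool) :
    Runs (pushes l) ⟨m, a, b, c⟩ 0 ⟨l ++ m, a, b, c⟩ := by
  induction l with
  | nil => exact .skip _
  | cons x l ih => exact .seq ih (.push _ _ _)

/-- Compare the stacks `b` and `c`; a bit is pushed on `a` for every difference. -/
def cmpLoop : Cmd :=
  loop .b true (pop .c (push .a true) skip (push .a true))
    (pop .c (push .a true) (push .a true) skip)

/-- A mismatch, or a bit of `b` without partner, leaves a mark on `a`; a surplus of `c` stays on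
`c`. The length bound controls the time needed to clear these remains. -/
theorem runs_cmpLoop (m a b c : List Bool) : ∃ a' c', (a' = [] ∧ c' = [] ↔ a = [] ∧ b = c) ∧
    a'.length + c'.length ≤ a.length + b.length + c.length ∧
    Runs cmpLoop ⟨m, a, b, c⟩ (b.length + 1) ⟨m, a', [], c'⟩ := by
  induction b generalizing a c with
  | nil => exact ⟨a, c, by simp [eq_comm], by simp, .loop_none rfl⟩
  | cons x b ih =>
    rcases c with _ | ⟨y, c⟩
    · obtain ⟨a', c', h, hl, h'⟩ := ih (true :: a) []
      refine ⟨a', c', by simp [h], by simp at hl ⊢; omega, ?_⟩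
      refine Runs.mono (n := 0 + (b.length + 1) + 1) ?_ (by simp)
      cases x
      · exact .loop_false b rfl (.pop_none rfl (.push _ _ _)) h'
      · exact .loop_true b rfl (.pop_none rfl (.push _ _ _)) h'
    · by_cases hxy : x = y
      · subst hxy
        obtain ⟨a', c', h, hl, h'⟩ := ih a c
        refine ⟨a', c', by simp [h], by simp at hl ⊢; omega, ?_⟩
        refine Runs.mono (n := 0 + (b.length + 1) + 1) ?_ (by simp)
        cases x
        · exact .loop_false b rfl (.pop_false c rfl (.skip _)) h'
        · exact .loop_true b rfl (.pop_true c rfl (.skip _)) h'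
      · obtain ⟨a', c', h, hl, h'⟩ := ih (true :: a) c
        refine ⟨a', c', by simp [h, hxy], by simp at hl ⊢; omega, ?_⟩
        refine Runs.mono (n := 0 + (b.length + 1) + 1) ?_ (by simp)
        cases x <;> cases y
        · exact absurd rfl hxy
        · exact .loop_false b rfl (.pop_true c rfl (.push _ _ _)) h'
        · exact .loop_true b rfl (.pop_false c rfl (.push _ _ _)) h'
        · exact absurd rfl hxy

/-- Replace the two top trees by the truth value of their equality. -/
def eq : Cmd :=
  seq take (seq (transfer .a .b) (seq take (seq (transfer .a .c) (seq cmpLoop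
    (seq (transfer .c .a)
      (pop .a (pushes [true, false, false])
        (seq (loop .a true skip skip) (push .m false))
        (seq (loop .a true skip skip) (push .m false))))))))

open Classical in
theorem runs_eq (x y : Bin) (r : List Bool) :
    Runs eq ⟨x.code ++ (y.code ++ r), [], [], []⟩ (6 * x.size + 6 * y.size + 10)
      ⟨(if x = y then [true, false, false] else [false]) ++ r, [], [], []⟩ := by
  obtain ⟨a', c', h, hl, h'⟩ := runs_cmpLoop r [] x.code y.code
  have hxy : c'.reverse ++ a' = [] ↔ x = y := by
    rw [← Bin.code_injective.eq_iff]
    simpa [and_comm] using h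
  refine Runs.mono (.seq (runs_take x _ [] []) (.seq (runs_transfer (by decide) _)
    (.seq (n := y.size + 1) (s' := ⟨r, y.code.reverse, x.code, []⟩) ?_
    (.seq (runs_transfer (by decide) _)
    (.seq (n := x.size + 1) (s' := ⟨r, a', [], c'⟩) ?_
    (.seq (n := c'.length + 1) (s' := ⟨r, c'.reverse ++ a', [], []⟩) ?_
    (n' := x.size + y.size + 1) ?_)))))) ?_
  · simpa [Store.get, Store.set] using runs_take y r [] x.code
  · simpa [Store.get, Store.set, Bin.size] using h'
  · simpa [Store.get, Store.set] using
      runs_transfer (k := .c) (j := .a) (by decide) ⟨r, a', [], c'⟩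
  · have hlen : (c'.reverse ++ a').length ≤ x.size + y.size := by
      simp [Bin.size] at hl ⊢
      omega
    generalize c'.reverse ++ a' = d at hxy hlen
    rcases d with _ | ⟨z, d⟩
    · rw [if_pos (hxy.1 rfl)]
      exact .pop_none rfl ((runs_pushes _ _ _ _ _).mono (Nat.zero_le _))
    · rw [if_neg (fun e => by simpa using hxy.2 e)]
      have := (Runs.seq (runs_clear r d [] []) (.push .m false _)).mono
        (n' := x.size + y.size + 1) (by simp at hlen; omega)
      cases z
      · exact .pop_false d rfl this
      · exact .pop_true d rfl this
  · simp [Store.get, Bin.size] at hl ⊢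
    omega

end Cmd

/-! ### Functions computed by programs in polynomial time -/

/-- Types whose elements are represented by trees. -/
class Enc (α : Type) where
  enc : α → Bin
  inj : Function.Injective enc

open Enc

namespace Enc

variable {α β : Type} [Enc α] [Enc β]

/-- The size of the representing tree. -/
def sz (x : α) : ℕ := (enc x).size

instance : Enc Unit where
  enc _ := .nil
  inj _ _ _ := rfl

instance : Enc Bool where
  enc b := bif b then .node .nil .nil else .nil
  inj a b h := by cases a <;> cases b <;> first | rfl | cases h

instance : Enc (α × β) where
  enc x := .node (enc x.1) (enc x.2)
  inj x y h := by
    injection h with h1 h2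
    exact Prod.ext (inj h1) (inj h2)

/-- Lists are represented as in Lisp. -/
def encList : List α → Bin
  | [] => .nil
  | a :: l => .node (enc a) (encList l)

theorem encList_injective : Function.Injective (encList (α := α)) := by
  intro l l' h
  induction l generalizing l' with
  | nil => cases l' with
    | nil => rfl
    | cons _ _ => cases h
  | cons a l ih => cases l' with
    | nil => cases h
    | cons _ _ =>
      injection h with h1 h2
      rw [inj h1, ih h2]

instance : Enc (List α) := ⟨encList, encList_injective⟩

/-- Numbers are unary, with the same trees as lists of units. Hence `length` and arithmetic reduce
to list operations, and polynomial bounds refer to the values of numbers. -/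
instance : Enc ℕ where
  enc n := enc (List.replicate n ())
  inj m n h := by simpa using congrArg List.length (inj h)

theorem enc_cons (a : α) (l : List α) : enc (a :: l) = .node (enc a) (enc l) := rfl

@[simp] theorem sz_unit (x : Unit) : sz x = 1 := rfl

@[simp] theorem sz_pair (x : α) (y : β) : sz (x, y) = sz x + sz y + 1 := Bin.size_node _ _

theorem sz_prod (x : α × β) : sz x = sz x.1 + sz x.2 + 1 := Bin.size_node _ _

@[simp] theorem sz_nil : sz ([] : List α) = 1 := rfl

@[simp] theorem sz_cons (a : α) (l : List α) : sz (a :: l) = sz a + sz l + 1 := Bin.size_node _ _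

theorem sz_pos (x : α) : 0 < sz x := Bin.size_pos _

theorem sz_bool (b : Bool) : sz b ≤ 3 := by
  cases b <;> decide

@[simp] theorem sz_nat (n : ℕ) : sz n = 2 * n + 1 := by
  change sz (List.replicate n ()) = _
  induction n with
  | zero => rfl
  | succ n ih => rw [List.replicate_succ, sz_cons, ih, sz_unit]; ring

theorem sz_append (l l' : List α) : sz (l ++ l') + 1 = sz l + sz l' := by
  induction l with
  | nil => simp; ring
  | cons a l ih => simp; omega

theorem sz_reverse (l : List α) : sz l.reverse = sz l := by
  induction l with
  | nil => rfl
  | cons a l ih =>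
    have := sz_append l.reverse [a]
    simp at this ⊢
    omega

theorem length_le_sz (l : List α) : l.length ≤ sz l := by
  induction l with
  | nil => simp
  | cons a l ih => simp; omega

theorem sz_le_of_mem {a : α} {l : List α} (h : a ∈ l) : sz a ≤ sz l := by
  induction l with
  | nil => simp at h
  | cons b l ih =>
    rcases List.mem_cons.1 h with rfl | h
    · simp; omega
    · have := ih h
      simp; omega

theorem sz_le_of_sublist {l l' : List α} (h : l.Sublist l') : sz l ≤ sz l' := by
  induction h with
  | slnil => exact le_rfl
  | cons a _ ih => simp; omega
  | cons_cons a _ ih => simp; omega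

theorem sz_le_of_forall_le {l : List α} {B : ℕ} (h : ∀ a ∈ l, sz a ≤ B) :
    sz l ≤ l.length * (B + 1) + 1 := by
  induction l with
  | nil => simp
  | cons a l ih =>
    have h1 := ih fun b hb => h b (List.mem_cons_of_mem _ hb)
    have h2 := h a List.mem_cons_self
    simp [add_mul] at h1 ⊢
    omega

end Enc

theorem polynomial_eval_mono (p : Polynomial ℕ) : Monotone fun n => p.eval n := by
  intro m n h
  induction p using Polynomial.induction_on' with
  | add p q hp hq =>
    simp only [Polynomial.eval_add] at *
    exact add_le_add hp hq
  | monomial k a =>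
    simp only [Polynomial.eval_monomial]
    gcongr

section

variable {α β γ δ : Type} [Enc α] [Enc β] [Enc γ] [Enc δ]

/-- Number-valued functions that are bounded by a polynomial in the size of the argument. -/
def PolyBdd (g : α → ℕ) : Prop := ∃ p : Polynomial ℕ, ∀ x, g x ≤ p.eval (sz x)

namespace PolyBdd

theorem mono {f g : α → ℕ} (hg : PolyBdd g) (h : ∀ x, f x ≤ g x) : PolyBdd f :=
  let ⟨p, hp⟩ := hg
  ⟨p, fun x => (h x).trans (hp x)⟩

theorem const (n : ℕ) : PolyBdd fun _ : α => n := ⟨Polynomial.C n, fun x => by simp⟩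

theorem add {f g : α → ℕ} (hf : PolyBdd f) (hg : PolyBdd g) : PolyBdd fun x => f x + g x :=
  let ⟨p, hp⟩ := hf
  let ⟨q, hq⟩ := hg
  ⟨p + q, fun x => by simpa using add_le_add (hp x) (hq x)⟩

theorem mul {f g : α → ℕ} (hf : PolyBdd f) (hg : PolyBdd g) : PolyBdd fun x => f x * g x :=
  let ⟨p, hp⟩ := hf
  let ⟨q, hq⟩ := hg
  ⟨p * q, fun x => by simpa using Nat.mul_le_mul (hp x) (hq x)⟩

theorem size : PolyBdd fun x : α => sz x := ⟨Polynomial.X, fun x => by simp⟩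

theorem comp {g : β → ℕ} {f : α → β} (hg : PolyBdd g) (hf : PolyBdd fun x => sz (f x)) :
    PolyBdd fun x => g (f x) :=
  let ⟨p, hp⟩ := hf
  let ⟨q, hq⟩ := hg
  ⟨q.comp p, fun x => (hq (f x)).trans <| by
    rw [Polynomial.eval_comp]
    exact polynomial_eval_mono q (hp x)⟩

theorem eval {g : α → ℕ} (hg : PolyBdd g) (q : Polynomial ℕ) : PolyBdd fun x => q.eval (g x) :=
  let ⟨p, hp⟩ := hg
  ⟨q.comp p, fun x => by
    rw [Polynomial.eval_comp]
    exact polynomial_eval_mono q (hp x)⟩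

end PolyBdd

/-- The program `c` computes `f` on the top of the main stack, in time `n`. -/
def Computes (c : Cmd) (f : α → β) (n : α → ℕ) : Prop :=
  ∀ (x : α) (r : List Bool), Runs c ⟨(enc x).code ++ r, [], [], []⟩ (n x)
    ⟨(enc (f x)).code ++ r, [], [], []⟩

/-- Functions that a program computes in polynomial time. -/
@[fun_prop]
def PT (f : α → β) : Prop :=
  PolyBdd (fun x => sz (f x)) ∧ ∃ (c : Cmd) (n : α → ℕ), PolyBdd n ∧ Computes c f n

namespace PT

/-- Programs see only trees, so the same program serves every function with the same representing
trees, even if the target type is different. -/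
theorem of_enc_eq {f : α → β} {g : α → γ} (hf : PT f) (h : ∀ x, enc (g x) = enc (f x)) : PT g := by
  obtain ⟨hs, c, n, hn, hc⟩ := hf
  refine ⟨hs.mono fun x => (congrArg Bin.size (h x)).le, c, n, hn, fun x r => ?_⟩
  rw [h]
  exact hc x r

@[fun_prop]
theorem id : PT fun x : α => x :=
  ⟨PolyBdd.size, .skip, fun _ => 0, .const 0, fun _ _ => .skip _⟩

@[fun_prop]
theorem comp {g : β → γ} {f : α → β} (hg : PT g) (hf : PT f) : PT fun x => g (f x) := by
  obtain ⟨hfs, c, n, hn, hc⟩ := hf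
  obtain ⟨hgs, d, m, hm, hd⟩ := hg
  exact ⟨hgs.comp hfs, c.seq d, fun x => n x + m (f x), hn.add (hm.comp hfs),
    fun x r => (hc x r).seq (hd (f x) r)⟩

@[fun_prop]
theorem const (y : β) : PT fun _ : α => y := by
  refine ⟨.const _, Cmd.drop.seq (Cmd.pushes (enc y).code), fun x => 2 * sz x + 2 + 0, ?_,
    fun x r => ?_⟩
  · exact ((((PolyBdd.const 2).mul .size).add (.const 2)).add (.const 0))
  · exact (Cmd.runs_drop _ _).seq (Cmd.runs_pushes _ _ _ _ _)

@[fun_prop]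
-- The argument is duplicated, and each program runs on the top tree while the other tree rests
-- below it. A final `true` joins the two results into a node.
theorem pair {f : α → β} {g : α → γ} (hf : PT f) (hg : PT g) : PT fun x => (f x, g x) := by
  obtain ⟨hfs, c, n, hn, hc⟩ := hf
  obtain ⟨hgs, d, m, hm, hd⟩ := hg
  refine ⟨((hfs.add hgs).add (.const 1)).mono fun x => (sz_pair _ _).le,
    Cmd.dup.seq (c.seq (Cmd.swap.seq (d.seq (Cmd.swap.seq (.push .m true))))),
    fun x => (4 * sz x + 4) + (n x + ((4 * sz (f x) + 2 * sz x + 6) + (m x +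
      ((4 * sz (g x) + 2 * sz (f x) + 6) + 0)))), ?_, fun x r => ?_⟩
  · have h4 := PolyBdd.const (α := α) 4
    have h2 := PolyBdd.const (α := α) 2
    have h6 := PolyBdd.const (α := α) 6
    exact ((h4.mul .size).add h4).add (hn.add ((((h4.mul hfs).add (h2.mul .size)).add h6).add
      (hm.add ((((h4.mul hgs).add (h2.mul hfs)).add h6).add (.const 0)))))
  · refine (Cmd.runs_dup _ _).seq ((hc x _).seq ((Cmd.runs_swap _ _ _).seq ((hd x _).seq
      ((Cmd.runs_swap _ _ _).seq ?_))))
    have := Runs.push .m true ⟨(enc (f x)).code ++ ((enc (g x)).code ++ r), [], [], []⟩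
    simpa [Store.set, Store.get, enc, Bin.code] using this

@[fun_prop]
theorem fst {f : α → β × γ} (hf : PT f) : PT fun x => (f x).1 := by
  refine comp (g := fun x : β × γ => x.1) ?_ hf
  refine ⟨PolyBdd.size.mono fun x => by dsimp only; rw [sz_prod x]; omega,
    .pop .m .skip (Cmd.swap.seq Cmd.drop) .skip,
    fun x => (4 * sz x + 2 * sz x + 6) + (2 * sz x + 2), ?_, fun x r => ?_⟩
  · have h2 := PolyBdd.const (α := β × γ) 2
    exact ((((PolyBdd.const 4).mul .size).add (h2.mul .size)).add (.const 6)).add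
      ((h2.mul .size).add h2)
  · refine .pop_true ((enc x.1).code ++ ((enc x.2).code ++ r))
      (by simp [Store.get, enc, Bin.code]) (((Cmd.runs_swap _ _ _).seq (Cmd.runs_drop _ _)).mono ?_)
    dsimp only
    rw [sz_prod x]
    simp only [sz]
    omega

@[fun_prop]
theorem snd {f : α → β × γ} (hf : PT f) : PT fun x => (f x).2 := by
  refine comp (g := fun x : β × γ => x.2) ?_ hf
  refine ⟨PolyBdd.size.mono fun x => by dsimp only; rw [sz_prod x]; omega, .pop .m .skip Cmd.drop .skip,
    fun x => 2 * sz x + 2, ((PolyBdd.const 2).mul .size).add (.const 2), fun x r => ?_⟩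
  refine .pop_true ((enc x.1).code ++ ((enc x.2).code ++ r))
    (by simp [Store.get, enc, Bin.code]) ((Cmd.runs_drop _ _).mono ?_)
  dsimp only
  rw [sz_prod x]
  simp only [sz]
  omega

@[fun_prop]
theorem cond {b : α → Bool} {f g : α → β} (hb : PT b) (hf : PT f) (hg : PT g) :
    PT fun x => bif b x then f x else g x := by
  have key : PT fun x : Bool × α => bif x.1 then f x.2 else g x.2 := by
    obtain ⟨hfs, c, n, hn, hc⟩ := hf
    obtain ⟨hgs, d, m, hm, hd⟩ := hg
    have h2 : PolyBdd fun x : Bool × α => sz x.2 := PolyBdd.size.mono fun x => by rw [sz_prod x]; omega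
    refine ⟨((hfs.comp h2).add (hgs.comp h2)).mono fun x => ?_,
      -- The first `pop` removes the tag of the pair, the second reads the truth value. The code of
      -- `true` has two more bits to be removed; the branches filled with `skip` never occur.
      .pop .m .skip (.pop .m .skip (.pop .m .skip .skip (.pop .m .skip .skip c)) d) .skip,
      fun x => n x.2 + m x.2, (hn.comp h2).add (hm.comp h2), fun x r => ?_⟩
    · obtain ⟨b, x⟩ := x
      cases b <;> simp
    · obtain ⟨b, x⟩ := x
      cases b
      · exact .pop_true (false :: ((enc x).code ++ r)) rfl (.pop_false ((enc x).code ++ r) rfl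
          ((hd x r).mono (by simp)))
      · exact .pop_true (true :: false :: false :: ((enc x).code ++ r)) rfl (.pop_true
          (false :: false :: ((enc x).code ++ r)) rfl (.pop_false (false :: ((enc x).code ++ r)) rfl
          (.pop_false ((enc x).code ++ r) rfl ((hc x r).mono (by simp)))))
  exact key.comp (hb.pair .id)

@[fun_prop]
theorem cons {f : α → β} {g : α → List β} (hf : PT f) (hg : PT g) : PT fun x => f x :: g x :=
  (hf.pair hg).of_enc_eq fun _ => rfl

@[fun_prop]
theorem tail {f : α → List β} (hf : PT f) : PT fun x => (f x).tail := by
  refine comp (g := fun l : List β => l.tail) ?_ hf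
  refine ⟨PolyBdd.size.mono fun l => sz_le_of_sublist (List.tail_sublist l),
    .pop .m .skip Cmd.drop (.push .m false),
    fun x => 2 * sz x + 2, ((PolyBdd.const 2).mul .size).add (.const 2), fun l r => ?_⟩
  rcases l with _ | ⟨a, l⟩
  · exact .pop_false r rfl ((Runs.push _ _ _).mono (by simp))
  · refine .pop_true ((enc a).code ++ ((enc l).code ++ r))
      (by simp [Store.get, enc_cons, Bin.code]) ((Cmd.runs_drop _ _).mono ?_)
    simp only [sz_cons]
    simp only [sz]
    omega

@[fun_prop]
theorem headD {f : α → List β} (hf : PT f) (d : β) : PT fun x => (f x).headD d := by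
  refine comp (g := fun l : List β => l.headD d) ?_ hf
  refine ⟨(PolyBdd.size.add (.const (sz d))).mono fun l => ?_,
    .pop .m .skip (Cmd.swap.seq Cmd.drop) (Cmd.pushes (enc d).code),
    fun x => (4 * sz x + 2 * sz x + 6) + (2 * sz x + 2), ?_, fun l r => ?_⟩
  · cases l <;> simp; omega
  · have h2 := PolyBdd.const (α := List β) 2
    exact ((((PolyBdd.const 4).mul .size).add (h2.mul .size)).add (.const 6)).add
      ((h2.mul .size).add h2)
  · rcases l with _ | ⟨a, l⟩
    · exact .pop_false r rfl ((Cmd.runs_pushes _ _ _ _ _).mono (by simp))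
    · refine .pop_true ((enc a).code ++ ((enc l).code ++ r))
        (by simp [Store.get, enc_cons, Bin.code])
        (((Cmd.runs_swap _ _ _).seq (Cmd.runs_drop _ _)).mono ?_)
      simp only [sz_cons]
      simp only [sz]
      omega

@[fun_prop]
theorem decideEq [DecidableEq β] {f g : α → β} (hf : PT f) (hg : PT g) :
    PT fun x => decide (f x = g x) := by
  have key : PT fun x : β × β => decide (x.1 = x.2) := by
    refine ⟨(PolyBdd.const 3).mono fun x => sz_bool _, .pop .m .skip Cmd.eq .skip,
      fun x => 6 * sz x + 6 * sz x + 10, ?_, fun x r => ?_⟩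
    · have h6 := PolyBdd.const (α := β × β) 6
      exact (((h6.mul .size).add (h6.mul .size)).add (.const 10))
    · obtain ⟨x, y⟩ := x
      refine .pop_true ((enc x).code ++ ((enc y).code ++ r))
        (by simp [Store.get, enc, Bin.code])
        (Runs.mono (n := 6 * sz x + 6 * sz y + 10) ?_ (by simp only [sz_pair]; omega))
      have h := Cmd.runs_eq (enc x) (enc y) r
      by_cases hxy : x = y
      · subst hxy
        simpa [enc, Bin.code, Store.set, sz] using h
      · rw [if_neg (fun e => hxy (inj e))] at h
        simpa [hxy, enc, Bin.code, Store.set, sz] using h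
  exact key.comp (hf.pair hg)

end PT

/-! ### Iteration over lists -/

/-- Run `c` on the pair of the two top trees until the first of them is empty, and drop that. -/
def Cmd.while (c : Cmd) : Cmd :=
  loop .m false (seq (push .m true) (seq (push .m true) (seq c (pop .m skip skip skip)))) skip

/-- Between rounds the tag of the pair is absent, so the loop test sees the tag of the list. A
`true` is put back together with the tag of the pair before `c` runs; a `false` is the whole empty
list, which is thereby dropped. -/
theorem runs_while {c : Cmd} {h : List α × β → List α × β} {n : List α × β → ℕ}
    (hc : Computes c h n) (N B : ℕ) (x : List α × β) (r : List Bool) (hN : (h^[N] x).1 = [])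
    (hlt : ∀ i < N, (h^[i] x).1 ≠ [] ∧ n (h^[i] x) ≤ B) :
    Runs c.while ⟨(enc x.1).code ++ ((enc x.2).code ++ r), [], [], []⟩ (N * (B + 1) + 1)
      ⟨(enc (h^[N] x).2).code ++ r, [], [], []⟩ := by
  induction N generalizing x with
  | zero =>
    obtain ⟨l, y⟩ := x
    change l = [] at hN
    subst hN
    exact (Runs.loop_exit _ rfl (.skip _)).mono (by simp)
  | succ N ih =>
    have hx := hlt 0 (by omega)
    have h' := ih (h x) hN fun i hi => hlt (i + 1) (by omega)
    obtain ⟨l, y⟩ := x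
    rcases l with _ | ⟨a, l⟩
    · exact absurd rfl hx.1
    refine Runs.mono (n := (0 + (0 + (B + 0))) + (N * (B + 1) + 1) + 1) ?_ (by ring_nf; omega)
    refine .loop_true ((enc a).code ++ ((enc l).code ++ ((enc y).code ++ r)))
      (by simp [Store.get, enc_cons, Bin.code]) ?_ h'
    refine .seq (.push _ _ _) (.seq (.push _ _ _)
      (.seq (s' := ⟨(enc (h (a :: l, y))).code ++ r, [], [], []⟩) ?_ ?_))
    · have := (hc (a :: l, y) r).mono hx.2
      simpa [Store.get, Store.set, enc, encList, Bin.code] using this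
    · exact .pop_true _ (by simp [Store.get, enc, Bin.code]) (.skip _)

namespace PT

/-- Iterating a polynomial-time step may produce exponentially large values, whence `hb`. It speaks
of all lists, not only of `l c`, so as to cover the prefixes of `l c`, whose folds are the
intermediate accumulators. -/
theorem foldl [Inhabited α] {f : γ → β → α → β} {l : γ → List α} {init : γ → β}
    (hf : PT fun x : γ × (β × α) => f x.1 x.2.1 x.2.2) (hl : PT l) (hi : PT init)
    (hb : PolyBdd fun x : γ × List α => sz (x.2.foldl (f x.1) (init x.1))) :
    PT fun c => (l c).foldl (f c) (init c) := by
  obtain ⟨q, hq⟩ := hb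
  let h : List α × (γ × β) → List α × (γ × β) :=
    -- The `default` is never used by the loop, which stops as soon as the list is empty.
    fun x => (x.1.tail, (x.2.1, f x.2.1 x.2.2 (x.1.headD default)))
  have hh : PT h := by
    have h1 : PT fun x : List α × (γ × β) => x.2.1 := (snd id).fst
    exact id.fst.tail.pair (h1.pair (hf.comp
      (h1.pair (id.snd.snd.pair (id.fst.headD default)))))
  obtain ⟨-, d, n, ⟨p, hp⟩, hd⟩ := hh
  obtain ⟨-, e, m, hm, he⟩ := hl.pair (id.pair hi)
  have iter : ∀ (i : ℕ) (l : List α) (c : γ) (b : β), i ≤ l.length →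
      h^[i] (l, (c, b)) = (l.drop i, (c, (l.take i).foldl (f c) b)) := by
    intro i
    induction i with
    | zero => simp
    | succ i ih =>
      intro l c b hil
      rcases l with _ | ⟨a, l⟩
      · simp at hil
      · exact ih l c (f c b a) (by simpa using hil)
  have hsz : ∀ (c : γ) (i : ℕ), sz (((l c).take i).foldl (f c) (init c)) ≤
      q.eval (sz c + sz (l c) + 1) := fun c i => by
    refine (hq (c, (l c).take i)).trans (polynomial_eval_mono q ?_)
    rw [sz_pair]
    have := sz_le_of_sublist (List.take_sublist i (l c))
    omega
  have hbd : PolyBdd fun c => q.eval (sz c + sz (l c) + 1) :=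
    ((PolyBdd.size.add hl.1).add (.const 1)).eval q
  have key : PT fun c => (c, (l c).foldl (f c) (init c)) := by
    refine ⟨((PolyBdd.size.add hbd).add (.const 1)).mono fun c => ?_,
      e.seq ((Cmd.pop .m .skip .skip .skip).seq d.while), fun c => m c + (0 + ((l c).length *
        (p.eval (sz (l c) + (sz c + q.eval (sz c + sz (l c) + 1) + 1) + 1) + 1) + 1)),
      ?_, fun c r => ?_⟩
    · have := hsz c (l c).length
      rw [List.take_length] at this
      rw [sz_pair]
      omega
    · exact hm.add ((PolyBdd.const 0).add (((hl.1.mono fun c => length_le_sz _).mul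
        (((((hl.1).add ((PolyBdd.size.add hbd).add (.const 1))).add (.const 1)).eval p).add
          (.const 1))).add (.const 1)))
    · refine (he c r).seq (.seq (s' := ⟨(enc (l c)).code ++ ((enc (c, init c)).code ++ r),
        [], [], []⟩) (.pop_true _ (by simp [Store.get, enc, Bin.code]) (.skip _)) ?_)
      have hN := iter (l c).length (l c) c (init c) le_rfl
      have := runs_while hd (l c).length
        (p.eval (sz (l c) + (sz c + q.eval (sz c + sz (l c) + 1) + 1) + 1)) (l c, (c, init c)) r
        (by rw [hN]; simp) fun i hi => ?_
      · rw [hN, List.take_length] at this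
        exact this
      · rw [iter i _ _ _ hi.le]
        refine ⟨by simpa using hi, (hp _).trans (polynomial_eval_mono p ?_)⟩
        have h1 := hsz c i
        have h2 := sz_le_of_sublist (List.drop_sublist i (l c))
        simp only [sz_pair]
        omega
  exact key.snd

end PT

end

theorem Enc.sz_flatMap_le {α β : Type} [Enc β] (l : List α) (g : α → List β) (B : ℕ)
    (h : ∀ a ∈ l, sz (g a) ≤ B) : sz (l.flatMap g) ≤ l.length * B + 1 := by
  induction l with
  | nil => simp
  | cons a l ih =>
    have h1 := ih fun b hb => h b (List.mem_cons_of_mem _ hb)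
    have h2 := h a List.mem_cons_self
    have h3 := sz_append (g a) (l.flatMap g)
    simp [add_mul] at h1 ⊢
    omega

namespace PT

variable {α β γ : Type} [Enc α] [Enc β] [Enc γ]

/-! ### Polynomial-time functions on truth values, lists and numbers -/

@[fun_prop]
theorem not {f : γ → Bool} (hf : PT f) : PT fun c => !f c :=
  (hf.cond (const false) (const true)).of_enc_eq fun c => by cases f c <;> rfl

@[fun_prop]
theorem and {f g : γ → Bool} (hf : PT f) (hg : PT g) : PT fun c => f c && g c :=
  (hf.cond hg (const false)).of_enc_eq fun c => by cases f c <;> rfl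

@[fun_prop]
theorem or {f g : γ → Bool} (hf : PT f) (hg : PT g) : PT fun c => f c || g c :=
  (hf.cond (const true) hg).of_enc_eq fun c => by cases f c <;> rfl

@[fun_prop]
theorem isEmpty {f : γ → List α} (hf : PT f) : PT fun c => (f c).isEmpty := by
  classical
  exact (hf.decideEq (const [])).of_enc_eq fun c => by cases f c <;> simp

@[fun_prop]
theorem reverseAppend [Inhabited α] {l l' : γ → List α} (hl : PT l) (hl' : PT l') :
    PT fun c => (l c).reverse ++ l' c := by
  have h (l l' : List α) : l.foldl (fun acc a => a :: acc) l' = l.reverse ++ l' := by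
    simp
  have h' : PT fun c => (l c).foldl (fun acc a => a :: acc) (l' c) := by
    refine foldl (f := fun _ acc a => a :: acc) (by fun_prop) hl hl' ?_
    have h1 : PolyBdd fun x : γ × List α => sz x.2 := (snd id).1
    have h2 : PolyBdd fun x : γ × List α => sz (l' x.1) := (hl'.comp (fst id)).1
    refine (h1.add h2).mono fun x => ?_
    rw [h]
    have := sz_append x.2.reverse (l' x.1)
    rw [sz_reverse] at this
    omega
  simpa only [h] using h'

@[fun_prop]
theorem reverse [Inhabited α] {l : γ → List α} (hl : PT l) : PT fun c => (l c).reverse := by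
  simpa using hl.reverseAppend (const [])

@[fun_prop]
theorem append [Inhabited α] {l l' : γ → List α} (hl : PT l) (hl' : PT l') :
    PT fun c => l c ++ l' c := by
  simpa using hl.reverse.reverseAppend hl'

@[fun_prop]
theorem flatMap [Inhabited α] [Inhabited β] {f : γ → α → List β} {l : γ → List α}
    (hf : PT fun x : γ × α => f x.1 x.2) (hl : PT l) : PT fun c => (l c).flatMap (f c) := by
  have h (c : γ) (l : List α) (r : List β) :
      l.foldl (fun acc a => acc ++ f c a) r = r ++ l.flatMap (f c) := by
    induction l generalizing r with
    | nil => simp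
    | cons a l ih => simp [ih]
  have h' : PT fun c => (l c).foldl (fun acc a => acc ++ f c a) [] := by
    refine foldl (f := fun c acc a => acc ++ f c a) ?_ hl (const []) ?_
    · have h1 : PT fun x : γ × (List β × α) => (x.1, x.2.2) := by fun_prop
      exact append (snd id).fst (hf.comp h1)
    · obtain ⟨p, hp⟩ := hf.1
      have h1 : PolyBdd fun x : γ × List α => sz x.2 := (snd id).1
      refine ((h1.mul (PolyBdd.size.eval p)).add (.const 1)).mono fun x => ?_
      rw [h, List.nil_append]
      refine (sz_flatMap_le _ _ (p.eval (sz x)) fun a ha => ?_).trans ?_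
      · refine (hp (x.1, a)).trans (polynomial_eval_mono p ?_)
        have := sz_le_of_mem ha
        rw [sz_prod x, sz_pair]
        omega
      · gcongr
        exact length_le_sz _
  simpa only [h, List.nil_append] using h'

@[fun_prop]
theorem map [Inhabited α] [Inhabited β] {f : γ → α → β} {l : γ → List α}
    (hf : PT fun x : γ × α => f x.1 x.2) (hl : PT l) : PT fun c => (l c).map (f c) := by
  have h : PT fun c => (l c).flatMap fun a => [f c a] := by fun_prop
  simpa only [← List.map_eq_flatMap] using h

@[fun_prop]
theorem filter [Inhabited α] {f : γ → α → Bool} {l : γ → List α}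
    (hf : PT fun x : γ × α => f x.1 x.2) (hl : PT l) : PT fun c => (l c).filter (f c) := by
  have h : PT fun c => (l c).flatMap fun a => bif f c a then [a] else [] := by fun_prop
  have e (c : γ) (l : List α) : (l.flatMap fun a => bif f c a then [a] else []) =
      l.filter (f c) := by
    induction l with
    | nil => rfl
    | cons a l ih =>
      rw [List.flatMap_cons, ih, List.filter_cons]
      cases f c a <;> rfl
  simpa only [e] using h

@[fun_prop]
theorem any [Inhabited α] {f : γ → α → Bool} {l : γ → List α}
    (hf : PT fun x : γ × α => f x.1 x.2) (hl : PT l) : PT fun c => (l c).any (f c) := by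
  have h : PT fun c => !((l c).filter (f c)).isEmpty := by fun_prop
  refine h.of_enc_eq fun c => ?_
  congr 1
  rw [Bool.eq_iff_iff]
  simp

@[fun_prop]
theorem all [Inhabited α] {f : γ → α → Bool} {l : γ → List α}
    (hf : PT fun x : γ × α => f x.1 x.2) (hl : PT l) : PT fun c => (l c).all (f c) := by
  have h : PT fun c => !((l c).any fun a => !f c a) := by fun_prop
  refine h.of_enc_eq fun c => ?_
  congr 1
  rw [Bool.eq_iff_iff]
  simp

@[fun_prop]
theorem decideMem [Inhabited α] [DecidableEq α] {a : γ → α} {l : γ → List α}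
    (ha : PT a) (hl : PT l) : PT fun c => decide (a c ∈ l c) := by
  have h : PT fun c => (l c).any fun b => decide (a c = b) := by fun_prop
  refine h.of_enc_eq fun c => ?_
  congr 1
  rw [Bool.eq_iff_iff]
  simp

@[fun_prop]
theorem length [Inhabited α] {l : γ → List α} (hl : PT l) : PT fun c => (l c).length := by
  have h : PT fun c => (l c).map fun _ => () := by fun_prop
  refine h.of_enc_eq fun c => ?_
  change enc (List.replicate _ ()) = _
  simp [List.map_const']

@[fun_prop]
theorem replicate [Inhabited α] {n : γ → ℕ} {a : γ → α} (hn : PT n) (ha : PT a) :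
    PT fun c => List.replicate (n c) (a c) := by
  have h : PT fun c => List.replicate (n c) () := hn.of_enc_eq fun c => rfl
  have h' : PT fun c => (List.replicate (n c) ()).map fun _ => a c := by fun_prop
  simpa using h'

@[fun_prop]
theorem add {m n : γ → ℕ} (hm : PT m) (hn : PT n) : PT fun c => m c + n c := by
  have h : PT fun c => (List.replicate (m c) () ++ List.replicate (n c) ()).length := by fun_prop
  simpa using h

@[fun_prop]
theorem mul {m n : γ → ℕ} (hm : PT m) (hn : PT n) : PT fun c => m c * n c := by
  have h : PT fun c =>
      ((List.replicate (m c) ()).flatMap fun _ => List.replicate (n c) ()).length := by fun_prop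
  simpa using h

@[fun_prop]
theorem drop [Inhabited α] {n : γ → ℕ} {l : γ → List α} (hn : PT n) (hl : PT l) :
    PT fun c => (l c).drop (n c) := by
  have e (l : List α) (r : List Unit) :
      r.foldl (fun acc _ => acc.tail) l = l.drop r.length := by
    induction r generalizing l with
    | nil => rfl
    | cons a r ih =>
      rw [List.foldl_cons, ih, List.drop_tail, List.length_cons]
  have h : PT fun c => (List.replicate (n c) ()).foldl (fun acc _ => acc.tail) (l c) := by
    refine foldl (f := fun (_ : γ) (acc : List α) (_ : Unit) => acc.tail) (by fun_prop) (by fun_prop) hl ?_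
    have h2 : PolyBdd fun x : γ × List Unit => sz (l x.1) := (hl.comp (fst id)).1
    refine h2.mono fun x => ?_
    rw [e]
    exact sz_le_of_sublist (List.drop_sublist _ _)
  simpa only [e, List.length_replicate] using h

@[fun_prop]
theorem sub {m n : γ → ℕ} (hm : PT m) (hn : PT n) : PT fun c => m c - n c := by
  have h : PT fun c => ((List.replicate (m c) ()).drop (n c)).length := by fun_prop
  simpa using h

@[fun_prop]
theorem take [Inhabited α] {n : γ → ℕ} {l : γ → List α} (hn : PT n) (hl : PT l) :
    PT fun c => (l c).take (n c) := by
  have h : PT fun c => ((l c).reverse.drop ((l c).length - n c)).reverse := by fun_prop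
  refine h.of_enc_eq fun c => ?_
  rw [List.drop_reverse, List.reverse_reverse]
  rcases le_total (n c) (l c).length with h | h
  · rw [Nat.sub_sub_self h]
  · rw [Nat.sub_eq_zero_of_le h, Nat.sub_zero, List.take_length, List.take_of_length_le h]

@[fun_prop]
theorem getD [Inhabited α] {n : γ → ℕ} {l : γ → List α} (hn : PT n) (hl : PT l) (d : α) :
    PT fun c => (l c).getD (n c) d := by
  have h : PT fun c => ((l c).drop (n c)).headD d := by fun_prop
  refine h.of_enc_eq fun c => ?_
  rw [List.headD_eq_head?_getD, List.head?_drop, List.getD_eq_getElem?_getD]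

@[fun_prop]
theorem range {n : γ → ℕ} (hn : PT n) : PT fun c => List.range (n c) := by
  have e (r : List Unit) : r.foldl (fun acc _ => acc ++ [acc.length]) [] =
      List.range r.length := by
    induction r using List.reverseRecOn with
    | nil => rfl
    | append_singleton r a ih => simp [ih, List.range_succ]
  have h : PT fun c => (List.replicate (n c) ()).foldl (fun acc _ => acc ++ [acc.length]) [] := by
    refine foldl (f := fun (_ : γ) (acc : List ℕ) (_ : Unit) => acc ++ [acc.length]) (by fun_prop) (by fun_prop)
      (const []) ?_
    have h2 : PolyBdd fun x : γ × List Unit => x.2.length :=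
      (snd id).1.mono fun x => length_le_sz x.2
    refine ((h2.mul (((PolyBdd.const 2).mul h2).add (.const 2))).add (.const 1)).mono fun x => ?_
    rw [e]
    refine (sz_le_of_forall_le (B := 2 * x.2.length + 1) fun a ha => ?_).trans (by simp)
    rw [sz_nat]
    have := List.mem_range.1 ha
    omega
  simpa only [e, List.length_replicate] using h

end PT

/-! ### Graph search -/

/-- Add the new elements of a list to a list without repetitions. -/
def insertNew {ν : Type} [DecidableEq ν] (vis ys : List ν) : List ν :=
  ys.foldl (fun acc y => bif decide (y ∈ acc) then acc else y :: acc) vis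

/-- New elements go to the front and `vis` stays a suffix. Therefore `searchStep` can recover the
new elements from the difference of the lengths. -/
theorem exists_insertNew_eq {ν : Type} [DecidableEq ν] (vis ys : List ν) (h : vis.Nodup) :
    ∃ new, insertNew vis ys = new ++ vis ∧ (new ++ vis).Nodup ∧
      ∀ y, y ∈ new ++ vis ↔ y ∈ ys ∨ y ∈ vis := by
  induction ys generalizing vis with
  | nil => exact ⟨[], rfl, h, by simp⟩
  | cons a ys ih =>
    rw [insertNew, List.foldl_cons]
    by_cases ha : a ∈ vis
    · simp only [ha, decide_true, cond_true]
      obtain ⟨new, h1, h2, h3⟩ := ih vis h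
      refine ⟨new, h1, h2, fun y => ?_⟩
      rw [h3, List.mem_cons]
      constructor
      · tauto
      · rintro ((rfl | h) | h) <;> tauto
    · simp only [ha, decide_false, cond_false]
      obtain ⟨new, h1, h2, h3⟩ := ih (a :: vis) (List.nodup_cons.2 ⟨ha, h⟩)
      have e : new ++ [a] ++ vis = new ++ a :: vis := by simp
      refine ⟨new ++ [a], by rw [e]; exact h1, by rwa [e], fun y => ?_⟩
      rw [e, h3, List.mem_cons, List.mem_cons]
      tauto

section

variable {ε ν : Type} [DecidableEq ν] [Inhabited ν]

/-- The state of a search: the vertices to be processed, the vertices found, whether a bad one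
has been met, and the data that describe the graph. -/
abbrev SearchState (ε ν : Type) : Type := List ν × (List ν × (Bool × ε))

/-- The start of a search. -/
def searchInit (init : ε → List ν) (e : ε) : SearchState ε ν :=
  (insertNew [] (init e), (insertNew [] (init e), (false, e)))

/-- Process one vertex. -/
def searchStep (succ : ε → ν → List ν) (bad : ε → ν → Bool) (s : SearchState ε ν) :
    SearchState ε ν :=
  bif bad s.2.2.2 (s.1.headD default) then ([], (s.2.1, (true, s.2.2.2)))
  else
    ((insertNew s.2.1 (succ s.2.2.2 (s.1.headD default))).take
      ((insertNew s.2.1 (succ s.2.2.2 (s.1.headD default))).length - s.2.1.length) ++ s.1.tail,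
      (insertNew s.2.1 (succ s.2.2.2 (s.1.headD default)), (false, s.2.2.2)))

/-- The vertices that can be reached. -/
inductive Reachable (succ : ν → List ν) (init : List ν) : ν → Prop
  | init {x : ν} : x ∈ init → Reachable succ init x
  | step {x y : ν} : Reachable succ init x → y ∈ succ x → Reachable succ init y

/-- The invariant of the search after `i` steps. -/
structure SearchInv (succ : ν → List ν) (bad : ν → Bool) (init : List ν) (i : ℕ)
    (todo vis : List ν) : Prop where
  nodup : vis.Nodup
  reachable : ∀ x ∈ vis, Reachable succ init x
  length : todo.length + i = vis.length
  init_mem : ∀ x ∈ init, x ∈ vis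
  todo_mem : ∀ x ∈ todo, x ∈ vis
  closed : ∀ x ∈ vis, x ∈ todo ∨ (bad x = false ∧ ∀ y ∈ succ x, y ∈ vis)

theorem SearchInv.step {succ : ε → ν → List ν} {bad : ε → ν → Bool} {init : List ν} {i : ℕ}
    {x : ν} {todo vis : List ν} {e : ε}
    (h : SearchInv (succ e) (bad e) init i (x :: todo) vis) (hx : bad e x = false) :
    ∃ todo' vis', searchStep succ bad (x :: todo, (vis, (false, e))) = (todo', (vis', (false, e))) ∧
      SearchInv (succ e) (bad e) init (i + 1) todo' vis' := by
  obtain ⟨new, h1, h2, h3⟩ := exists_insertNew_eq vis (succ e x) h.nodup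
  refine ⟨new ++ todo, new ++ vis, ?_, h2, ?_, ?_, ?_, ?_, ?_⟩
  · simp [searchStep, hx, h1]
  · intro y hy
    rcases (h3 y).1 hy with hy | hy
    · exact .step (h.reachable x (h.todo_mem x List.mem_cons_self)) hy
    · exact h.reachable y hy
  · have := h.length
    simp at this ⊢
    omega
  · exact fun y hy => List.mem_append_right _ (h.init_mem y hy)
  · intro y hy
    rcases List.mem_append.1 hy with hy | hy
    · exact List.mem_append_left _ hy
    · exact List.mem_append_right _ (h.todo_mem y (List.mem_cons_of_mem _ hy))
  · intro y hy
    rcases List.mem_append.1 hy with hy | hy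
    · exact .inl (List.mem_append_left _ hy)
    · rcases h.closed y hy with hy' | ⟨hb, hs⟩
      · rcases List.mem_cons.1 hy' with rfl | hy'
        · exact .inr ⟨hx, fun z hz => (h3 z).2 (.inl hz)⟩
        · exact .inl (List.mem_append_right _ hy')
      · exact .inr ⟨hb, fun z hz => List.mem_append_right _ (hs z hz)⟩

/-- With nothing left to process, `vis` contains the initial vertices and is closed under
successors; so it contains every reachable vertex, and all of its members have been tested. -/
theorem SearchInv.not_bad {μ : Type} {succ : μ → List μ} {bad : μ → Bool} {init : List μ} {i : ℕ}
    {vis : List μ} (h : SearchInv succ bad init i [] vis) {x : μ} (hx : Reachable succ init x) :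
    bad x = false := by
  have hv : x ∈ vis := by
    induction hx with
    | init hx => exact h.init_mem _ hx
    | step _ hy ih =>
      rcases h.closed _ ih with hx | hx
      · simp at hx
      · exact hx.2 _ hy
  rcases h.closed _ hv with hx | hx
  · simp at hx
  · exact hx.1

open Classical in
-- `vis` has no repetitions and stays inside `U`, which bounds both the number of rounds and the two
-- lists of the state. The size bound counts these two lists, `e`, the flag `false` and three pairs.
-- The induction is on the number `k` of vertices that may still be processed.
theorem search_spec [Enc ε] [Enc ν] {succ : ε → ν → List ν} {bad : ε → ν → Bool}
    {init : List ν} {e : ε} (U : Finset ν) (B : ℕ)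
    (hU : ∀ x, Reachable (succ e) init x → x ∈ U ∧ sz x ≤ B) (k i : ℕ) (todo vis : List ν)
    (h : SearchInv (succ e) (bad e) init i todo vis) (hk : U.card - i ≤ k) :
    ∃ N ≤ k + 1, ((searchStep succ bad)^[N] (todo, (vis, (false, e)))).1 = [] ∧
      ((searchStep succ bad)^[N] (todo, (vis, (false, e)))).2.2.1 =
        decide (∃ x, Reachable (succ e) init x ∧ bad e x = true) ∧
      sz ((searchStep succ bad)^[N] (todo, (vis, (false, e)))).2 ≤
        2 * (U.card * (B + 1) + 1) + sz e + 4 ∧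
      ∀ j < N, ((searchStep succ bad)^[j] (todo, (vis, (false, e)))).1 ≠ [] ∧
        sz ((searchStep succ bad)^[j] (todo, (vis, (false, e)))) ≤
          2 * (U.card * (B + 1) + 1) + sz e + 4 := by
  have hvis : ∀ i todo vis, SearchInv (succ e) (bad e) init i todo vis →
      vis.length ≤ U.card := fun i todo vis h => by
    rw [← List.toFinset_card_of_nodup h.nodup]
    exact Finset.card_le_card fun x hx => (hU x (h.reachable x (List.mem_toFinset.1 hx))).1
  have hs : ∀ i todo vis, SearchInv (succ e) (bad e) init i todo vis →
      sz (todo, (vis, (false, e))) ≤ 2 * (U.card * (B + 1) + 1) + sz e + 4 :=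
      fun i todo vis h => by
    have hsize : ∀ l : List ν, l.length ≤ U.card → (∀ x ∈ l, x ∈ vis) →
        sz l ≤ U.card * (B + 1) + 1 := fun l hl hm =>
      (sz_le_of_forall_le fun x hx => (hU x (h.reachable x (hm x hx))).2).trans (by gcongr)
    have hlen := h.length
    have h0 := hvis i todo vis h
    have h1 := hsize todo (by omega) h.todo_mem
    have h2 := hsize vis h0 fun _ h => h
    have h3 : sz false = 1 := rfl
    simp only [sz_pair]
    omega
  induction k generalizing i todo vis with
  | zero =>
    rcases todo with _ | ⟨x, todo⟩
    · refine ⟨0, by omega, rfl, ?_⟩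
      refine ⟨(decide_eq_false ?_).symm, (le_trans ?_ (hs _ _ _ h)), by simp⟩
      swap
      · simp
        omega
      rintro ⟨x, hx, hb⟩
      simp [h.not_bad hx] at hb
    · have h1 := h.length
      have h2 := hvis _ _ _ h
      simp at h1
      omega
  | succ k ih =>
    rcases todo with _ | ⟨x, todo⟩
    · refine ⟨0, by omega, rfl, ?_⟩
      refine ⟨(decide_eq_false ?_).symm, (le_trans ?_ (hs _ _ _ h)), by simp⟩
      swap
      · simp
        omega
      rintro ⟨x, hx, hb⟩
      simp [h.not_bad hx] at hb
    · rcases hx : bad e x with _ | _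
      · obtain ⟨todo', vis', h1, h2⟩ := h.step hx
        have h3 := h.length
        have h4 := hvis _ _ _ h
        obtain ⟨N, hN, hN1, hN2, hN3, hN4⟩ := ih (i + 1) todo' vis' h2 (by simp at h3; omega)
        refine ⟨N + 1, by omega, ?_, ?_, ?_, ?_⟩
        · rwa [Function.iterate_succ_apply, h1]
        · rwa [Function.iterate_succ_apply, h1]
        · rwa [Function.iterate_succ_apply, h1]
        · intro j hj
          rcases j with _ | j
          · exact ⟨by simp, hs _ _ _ h⟩
          · rw [Function.iterate_succ_apply, h1]
            exact hN4 j (by omega)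
      · refine ⟨1, by omega, ?_, ?_, ?_, ?_⟩
        · simp [searchStep, hx]
        · simp only [Function.iterate_one, searchStep, List.headD_cons, hx, cond_true]
          exact (decide_eq_true
            ⟨x, h.reachable x (h.todo_mem x List.mem_cons_self), hx⟩).symm
        -- The flag `true` is larger than `false` by two; the discarded nonempty list makes up for
        -- it.
        · refine le_trans ?_ (hs _ _ _ h)
          have h1 := sz_pos x
          have h2 := sz_pos todo
          have h3 : sz false = 1 := rfl
          have h4 : sz true = 3 := rfl
          simp [searchStep, hx]
          omega
        · intro j hj
          obtain rfl : j = 0 := by omega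
          exact ⟨by simp, hs _ _ _ h⟩

theorem PT.insertNew [Enc ε] [Enc ν] {vis ys : ε → List ν} (hv : PT vis) (hy : PT ys) :
    PT fun c => insertNew (vis c) (ys c) := by
  refine PT.foldl (f := fun (_ : ε) (acc : List ν) (y : ν) =>
    bif decide (y ∈ acc) then acc else y :: acc) (by fun_prop) hy hv ?_
  have h1 : PolyBdd fun x : ε × List ν => sz x.2 := (PT.snd .id).1
  have h2 : PolyBdd fun x : ε × List ν => sz (vis x.1) := (hv.comp (PT.fst .id)).1
  refine (h1.add h2).mono fun x => ?_
  have key (ys vis : List ν) : sz (ys.foldl (fun acc y =>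
      bif decide (y ∈ acc) then acc else y :: acc) vis) + 1 ≤ sz ys + sz vis := by
    induction ys generalizing vis with
    | nil => simp [add_comm]
    | cons a ys ih =>
      have := ih (bif decide (a ∈ vis) then vis else a :: vis)
      rw [List.foldl_cons]
      by_cases ha : a ∈ vis <;> simp [ha] at this ⊢
      · omega
      · omega
  have := key x.2 (vis x.1)
  omega

theorem PT.searchStep [Enc ε] [Enc ν] {succ : ε → ν → List ν} {bad : ε → ν → Bool}
    (hs : PT fun x : ε × ν => succ x.1 x.2) (hb : PT fun x : ε × ν => bad x.1 x.2) :
    PT (searchStep succ bad) := by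
  have hx : PT fun s : SearchState ε ν => (s.2.2.2, s.1.headD default) := by fun_prop
  have hn : PT fun s : SearchState ε ν =>
      StackProgram.insertNew s.2.1 (succ s.2.2.2 (s.1.headD default)) :=
    .insertNew (by fun_prop) (hs.comp hx)
  exact (hb.comp hx).cond (by fun_prop)
    ((((hn.length.sub (PT.length (by fun_prop))).take hn).append (by fun_prop)).pair
      (hn.pair (by fun_prop)))

open Classical in
-- The program and the polynomial are chosen before `U` and `B`, which enter only the time bound.
-- Thus one program terminates whenever a finite bound exists and is fast whenever a small one does.
theorem exists_search_program [Enc ε] [Enc ν] {succ : ε → ν → List ν} {bad : ε → ν → Bool}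
    {init : ε → List ν} (hs : PT fun x : ε × ν => succ x.1 x.2)
    (hb : PT fun x : ε × ν => bad x.1 x.2) (hi : PT init) :
    ∃ (c : Cmd) (p : Polynomial ℕ), ∀ (e : ε) (U : Finset ν) (B : ℕ),
      (∀ x, Reachable (succ e) (init e) x → x ∈ U ∧ sz x ≤ B) → ∀ r : List Bool,
      Runs c ⟨(enc e).code ++ r, [], [], []⟩ (p.eval (sz e + U.card * (B + 1)))
        ⟨(enc (decide (∃ x, Reachable (succ e) (init e) x ∧ bad e x = true))).code ++ r,
          [], [], []⟩ := by
  have h0 : PT (searchInit init) := by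
    have h : PT fun e : ε => insertNew [] (init e) := .insertNew (.const []) hi
    exact h.pair (h.pair (by fun_prop))
  obtain ⟨-, c₀, n₀, ⟨p₀, hp₀⟩, hc₀⟩ := h0
  obtain ⟨-, c₁, n₁, ⟨p₁, hp₁⟩, hc₁⟩ := PT.searchStep hs hb
  have h2 : PT fun s : List ν × (Bool × ε) => s.2.1 := by fun_prop
  obtain ⟨-, c₂, n₂, ⟨p₂, hp₂⟩, hc₂⟩ := h2
  refine ⟨c₀.seq ((Cmd.pop .m .skip .skip .skip).seq (c₁.while.seq c₂)),
    -- The terms account for the initialization, at most `X + 1` rounds on states of size at most `2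
    -- * X + 6`, the last loop test, and the extraction of the flag.
    p₀ + (Polynomial.X + 1) * (p₁.comp (2 * Polynomial.X + 6) + 1) + 1 +
      p₂.comp (2 * Polynomial.X + 6), fun e U B hU r => ?_⟩
  set X := sz e + U.card * (B + 1) with hX
  obtain ⟨new, h1, h2, h3⟩ := exists_insertNew_eq [] (init e) List.nodup_nil
  simp only [List.append_nil, List.not_mem_nil, or_false] at h1 h2 h3
  have hinv : SearchInv (succ e) (bad e) (init e) 0 new new :=
    ⟨h2, fun x hx => .init ((h3 x).1 hx), rfl, fun x hx => (h3 x).2 hx, fun _ h => h,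
      fun _ h => .inl h⟩
  obtain ⟨N, hN, hN1, hN2, hN3, hN4⟩ := search_spec U B hU _ 0 new new hinv le_rfl
  have hw := runs_while hc₁ N (p₁.eval (2 * X + 6)) (new, (new, (false, e))) r hN1
    fun i hi => ⟨(hN4 i hi).1, (hp₁ _).trans
      (polynomial_eval_mono p₁ ((hN4 i hi).2.trans (by omega)))⟩
  have h4 := hc₀ e r
  rw [searchInit, h1] at h4
  rw [← hN2]
  refine ((h4.mono ((hp₀ e).trans (polynomial_eval_mono p₀ (by omega : _ ≤ X)))).seq
    (.seq (s' := ⟨(enc new).code ++ ((enc (new, (false, e))).code ++ r), [], [], []⟩)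
      (.pop_true _ (by simp [Store.get, enc, Bin.code]) (.skip _))
      (hw.seq ((hc₂ _ r).mono ((hp₂ _).trans (polynomial_eval_mono p₂
        (hN3.trans (by omega : _ ≤ 2 * X + 6)))))))).mono ?_
  have h5 : N ≤ X + 1 := by
    have : U.card ≤ U.card * (B + 1) := Nat.le_mul_of_pos_right _ (Nat.succ_pos _)
    omega
  have h6 : N * (p₁.eval (2 * X + 6) + 1) ≤ (X + 1) * (p₁.eval (2 * X + 6) + 1) := by gcongr
  simp only [Polynomial.eval_add, Polynomial.eval_mul, Polynomial.eval_comp, Polynomial.eval_X,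
    Polynomial.eval_one, Polynomial.eval_ofNat]
  omega

end

/-! ### Machines that decide by search -/

/-- Convert the list of bits on the stack `a` to its tree on the stack `m`. -/
def Cmd.encodeInput : Cmd :=
  (transfer .a .b).seq ((push .m false).seq
    (loop .b true (pushes [true, true, false, false]) (pushes [true, false])))

/-- The tape is reversed first, because the tree of a list is built on the stack from its last
element. -/
theorem runs_encodeInput (l : List Bool) :
    Runs Cmd.encodeInput ⟨[], l, [], []⟩ (2 * l.length + 2) ⟨(enc l).code, [], [], []⟩ := by
  have key (b l : List Bool) : Runs
      (.loop .b true (Cmd.pushes [true, true, false, false]) (Cmd.pushes [true, false]))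
      ⟨(enc l).code, [], b, []⟩ (b.length + 1) ⟨(enc (b.reverse ++ l)).code, [], [], []⟩ := by
    induction b generalizing l with
    | nil => exact .loop_none rfl
    | cons x b ih =>
      have h := ih (x :: l)
      simp only [List.reverse_cons, List.append_assoc, List.singleton_append]
      refine Runs.mono (n := 0 + (b.length + 1) + 1) ?_ (by simp)
      cases x
      · exact .loop_false b rfl (Cmd.runs_pushes _ _ _ _ _) h
      · exact .loop_true b rfl (Cmd.runs_pushes _ _ _ _ _) h
  have h := key l.reverse []
  rw [List.reverse_reverse, List.append_nil, List.length_reverse] at h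
  refine Runs.mono (.seq (Cmd.runs_transfer (by decide) _) (.seq (.push _ _ _) ?_))
    (n := l.length + 1 + (0 + (l.length + 1))) (by omega)
  simpa [Store.get, Store.set, enc, encList, Bin.code] using h

/-- Replace the tree of a truth value by the bit of its negation. -/
def Cmd.outputNot : Cmd :=
  pop .m skip (pop .m skip skip (pop .m skip skip (push .m false))) (push .m true)

theorem runs_outputNot (b : Bool) :
    Runs Cmd.outputNot ⟨(enc b).code, [], [], []⟩ 0 ⟨[!b], [], [], []⟩ := by
  cases b
  · exact .pop_false [] rfl (.push _ _ _)
  · exact .pop_true [false, false] rfl (.pop_false [false] rfl (.pop_false [] rfl (.push _ _ _)))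

theorem sz_bits_le (l : List Bool) : sz l ≤ 4 * l.length + 1 := by
  have := sz_le_of_forall_le (l := l) (B := 3) fun b _ => sz_bool b
  omega

/-- One machine meets both requirements: `hfin` makes it halt on every input, `hpoly` makes the same
run short on the restricted inputs. The answer is negated since the search looks for a
counterexample. -/
theorem decidableAndPolyTime_of_search {ε ν : Type} [DecidableEq ν] [Inhabited ν] [Enc ε] [Enc ν]
    {parse : List Bool → ε} {succ : ε → ν → List ν} {bad : ε → ν → Bool} {init : ε → List ν}
    (hp : PT parse) (hs : PT fun x : ε × ν => succ x.1 x.2)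
    (hb : PT fun x : ε × ν => bad x.1 x.2) (hi : PT init) (P : SDIInput → Prop)
    (hP : ∀ I : SDIInput, P I ↔ ¬ ∃ x, Reachable (succ (parse I.encode)) (init (parse I.encode)) x ∧
      bad (parse I.encode) x = true)
    (hfin : ∀ I : SDIInput, ∃ (U : Finset ν) (B : ℕ),
      ∀ x, Reachable (succ (parse I.encode)) (init (parse I.encode)) x → x ∈ U ∧ sz x ≤ B)
    (hpoly : ∀ c : ℕ, ∃ q : Polynomial ℕ, ∀ I : SDIInput, I.Deterministic →
      (∀ w ∈ I.F, w.length ≤ c) → ∃ (U : Finset ν) (B : ℕ),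
      (∀ x, Reachable (succ (parse I.encode)) (init (parse I.encode)) x → x ∈ U ∧ sz x ≤ B) ∧
      U.card * (B + 1) ≤ q.eval I.encode.length) :
    DecidableAndPolyTimeOnBoundedDFA P := by
  classical
  obtain ⟨⟨p₀, hp₀⟩, c₁, n₁, ⟨p₁, hp₁⟩, hc₁⟩ := hp
  obtain ⟨c₂, p₂, hc₂⟩ := exists_search_program hs hb hi
  have main : ∀ (I : SDIInput) (U : Finset ν) (B : ℕ),
      (∀ x, Reachable (succ (parse I.encode)) (init (parse I.encode)) x → x ∈ U ∧ sz x ≤ B) →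
      Runs (Cmd.encodeInput.seq (c₁.seq (c₂.seq Cmd.outputNot))) ⟨[], I.encode, [], []⟩
        (2 * I.encode.length + 2 + (p₁.eval (4 * I.encode.length + 1) +
          (p₂.eval (p₀.eval (4 * I.encode.length + 1) + U.card * (B + 1)) + 0)))
        ⟨[decide (P I)], [], [], []⟩ := by
    intro I U B hU
    have h1 := (hc₁ I.encode []).mono
      ((hp₁ _).trans (polynomial_eval_mono p₁ (sz_bits_le I.encode)))
    have h2 := (hc₂ (parse I.encode) U B hU []).mono (polynomial_eval_mono p₂ (Nat.add_le_add_right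
      ((hp₀ I.encode).trans (polynomial_eval_mono p₀ (sz_bits_le I.encode))) _))
    rw [List.append_nil, List.append_nil] at h1 h2
    have h3 := runs_outputNot (decide (∃ x, Reachable (succ (parse I.encode))
      (init (parse I.encode)) x ∧ bad (parse I.encode) x = true))
    rw [← decide_not, decide_eq_decide.2 (hP I).symm] at h3
    exact (runs_encodeInput I.encode).seq (h1.seq (h2.seq h3))
  have e (I : SDIInput) : I.encode.map (Cmd.toComputableAux (Cmd.encodeInput.seq
      (c₁.seq (c₂.seq Cmd.outputNot)))).inputAlphabet.symm = I.encode := List.map_id _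
  refine ⟨Cmd.toComputableAux (Cmd.encodeInput.seq (c₁.seq (c₂.seq Cmd.outputNot))), fun I => ?_,
    fun c => ?_⟩
  · obtain ⟨U, B, hU⟩ := hfin I
    obtain ⟨t, -, ht⟩ := main I U B hU
    obtain ⟨h⟩ := Cmd.outputsInTime_of_exec ht le_rfl
    unfold CorrectOn
    rw [e I]
    exact ⟨h.toTM2Outputs⟩
  · obtain ⟨q, hq⟩ := hpoly c
    refine ⟨2 * Polynomial.X + 2 + (p₁.comp (4 * Polynomial.X + 1) +
      p₂.comp (p₀.comp (4 * Polynomial.X + 1) + q)) + 1, fun I hI hc => ?_⟩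
    obtain ⟨U, B, hU, hle⟩ := hq I hI hc
    obtain ⟨t, hn, ht⟩ := main I U B hU
    obtain ⟨h⟩ := Cmd.outputsInTime_of_exec (n := (2 * Polynomial.X + 2 +
      (p₁.comp (4 * Polynomial.X + 1) + p₂.comp (p₀.comp (4 * Polynomial.X + 1) + q)) +
      1 : Polynomial ℕ).eval I.encode.length) ht (by
        simp only [Polynomial.eval_add, Polynomial.eval_mul, Polynomial.eval_comp,
          Polynomial.eval_X, Polynomial.eval_one, Polynomial.eval_ofNat]
        have : p₂.eval (p₀.eval (4 * I.encode.length + 1) + U.card * (B + 1)) ≤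
            p₂.eval (p₀.eval (4 * I.encode.length + 1) + q.eval I.encode.length) :=
          polynomial_eval_mono p₂ (Nat.add_le_add_left hle _)
        omega)
    unfold CorrectOnInTime
    rw [e I]
    exact ⟨h⟩

/-! ### The decision algorithm -/

/-- The data read from the input tape: the number of states, the number of letters, the initial
state, a list that starts with the bits of the final states, a list that starts with the bits of
the transition table, and the strings. -/
abbrev Data : Type := ℕ × (ℕ × (ℕ × (List Bool × (List Bool × List (List ℕ)))))

namespace Data

/-- The bit of a transition. -/
def trans (D : Data) (q a r : ℕ) : Bool :=
  D.2.2.2.2.1.getD ((q * D.2.1 + a) * D.1 + r) false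

/-- The successors of a set of states, in increasing order. -/
def next (D : Data) (S : List ℕ) (a : ℕ) : List ℕ :=
  (List.range D.1).filter fun r => S.any fun q => D.trans q a r

/-- The states reached from a set of states by a string. -/
def run (D : Data) (S w : List ℕ) : List ℕ := w.foldl D.next S

/-- Whether a set of states contains a final one. -/
def accepting (D : Data) (S : List ℕ) : Bool := S.any fun q => D.2.2.2.1.getD q false

/-- A vertex of the search graph: whether the site of the insertion has been passed, the three
parts of the inserted string, the letters next to the site that are remembered, and the states
reached without and with the insertion. -/
abbrev Node : Type := Bool × (List ℕ × (List ℕ × (List ℕ × (List ℕ × (List ℕ × List ℕ)))))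

set_option synthInstance.maxSize 1000 in
instance : DecidableEq Node := inferInstance

/-- The vertices where the search starts. -/
def start (D : Data) : List Node :=
  D.2.2.2.2.2.flatMap fun y => (List.range (y.length + 1)).flatMap fun i =>
    (List.range (y.length + 1)).map fun j =>
      (false, (y.take i, ((y.drop i).take j, ((y.drop i).drop j, ([], ([D.2.2.1], []))))))

/-- The successors of a vertex; `c` is the condition on both sides of the site. -/
def succ (c : List ℕ × (List ℕ × List ℕ) → Bool) (D : Data) : Node → List Node
  | (ph, (u, (z, (v, (p, (S, T)))))) =>
    bif ph then
      (List.range D.2.1).map fun a =>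
        (true, (u, (z, (v, ((p ++ [a]).take z.length, (D.next S a, D.next T a))))))
    else
      ((List.range D.2.1).map fun a =>
        (false, (u, (z, (v, ((a :: p).take z.length, (D.next S a, [])))))) ) ++
      bif c (u.reverse, (z.reverse, p)) then
        [(true, (u, (z, (v, ([], (D.run S (u ++ v), D.run S (u ++ z ++ v)))))))]
      else []

/-- Whether a vertex shows that the language is not closed. -/
def bad (c : List ℕ × (List ℕ × List ℕ) → Bool) (D : Data) : Node → Bool
  | (ph, (_, (z, (v, (p, (S, T)))))) =>
    ph && (c (v, (z, p)) && (D.accepting S && !D.accepting T))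

section

variable {γ : Type} [Enc γ]

@[fun_prop]
theorem pt_trans {D : γ → Data} {q a r : γ → ℕ} (hD : PT D) (hq : PT q) (ha : PT a) (hr : PT r) :
    PT fun x => (D x).trans (q x) (a x) (r x) := by
  unfold trans
  fun_prop

@[fun_prop]
theorem pt_next {D : γ → Data} {S : γ → List ℕ} {a : γ → ℕ} (hD : PT D) (hS : PT S) (ha : PT a) :
    PT fun x => (D x).next (S x) (a x) := by
  unfold next
  fun_prop

theorem sz_sublist_range {n : ℕ} {l : List ℕ} (h : l.Sublist (List.range n)) :
    sz l ≤ n * (2 * n + 2) + 1 := by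
  refine (sz_le_of_sublist h).trans
    ((sz_le_of_forall_le (B := 2 * n + 1) fun a ha => ?_).trans (by simp))
  rw [sz_nat]
  have := List.mem_range.1 ha
  omega

theorem run_append_singleton (D : Data) (S w : List ℕ) (a : ℕ) :
    D.run S (w ++ [a]) = D.next (D.run S w) a := by
  simp [run]

theorem run_append (D : Data) (S w w' : List ℕ) :
    D.run S (w ++ w') = D.run (D.run S w) w' := by
  simp [run]

@[fun_prop]
-- The accumulator does not grow with `w`: after at least one letter it is a sublist of the range of
-- states, whatever `S` was.
theorem pt_run {D : γ → Data} {S w : γ → List ℕ} (hD : PT D) (hS : PT S) (hw : PT w) :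
    PT fun x => (D x).run (S x) (w x) := by
  refine PT.foldl (f := fun x S a => (D x).next S a) ?_ hw hS ?_
  · have h : PT fun x : γ × (List ℕ × ℕ) => D x.1 := hD.comp (.fst .id)
    fun_prop
  · have h1 : PolyBdd fun x : γ × List ℕ => sz (S x.1) := (hS.comp (.fst .id)).1
    have h2 : PolyBdd fun x : γ × List ℕ => sz (D x.1).1 := (hD.comp (.fst .id)).fst.1
    refine (h1.add ((h2.mul (((PolyBdd.const 2).mul h2).add (.const 2))).add (.const 1))).mono
      fun x => ?_
    rcases List.eq_nil_or_concat x.2 with h | ⟨l, a, h⟩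
    · simp [h]
    · rw [h, List.concat_eq_append, List.foldl_append]
      refine (sz_sublist_range (List.filter_sublist (l := List.range (D x.1).1))).trans ?_
      have : (D x.1).1 ≤ sz (D x.1).1 := by simp; omega
      generalize sz (D x.1).1 = m at *
      refine le_trans ?_ (Nat.le_add_left _ _)
      gcongr

@[fun_prop]
theorem pt_accepting {D : γ → Data} {S : γ → List ℕ} (hD : PT D) (hS : PT S) :
    PT fun x => (D x).accepting (S x) := by
  unfold accepting
  fun_prop

theorem pt_start : PT start := by
  unfold start
  fun_prop

theorem pt_succ {c : List ℕ × (List ℕ × List ℕ) → Bool} (hc : PT c) :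
    PT fun x : Data × Node => succ c x.1 x.2 := by
  have h : PT fun x : Data × Node => c (x.2.2.1.reverse, (x.2.2.2.1.reverse, x.2.2.2.2.2.1)) :=
    hc.comp (by fun_prop)
  unfold succ
  fun_prop

theorem pt_bad {c : List ℕ × (List ℕ × List ℕ) → Bool} (hc : PT c) :
    PT fun x : Data × Node => bad c x.1 x.2 := by
  have h : PT fun x : Data × Node => c (x.2.2.2.2.1, (x.2.2.2.1, x.2.2.2.2.2.1)) :=
    hc.comp (by fun_prop)
  unfold bad
  fun_prop

end

/-! ### Reading the input -/

/-- One step in reading a number in unary notation. -/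
def unaryStep (s : ℕ × Bool) (b : Bool) : ℕ × Bool :=
  bif s.2 && b then (s.1 + 1, true) else (s.1, false)

/-- The number that a list of bits starts with. -/
def unaryLength (l : List Bool) : ℕ := (l.foldl unaryStep (0, true)).1

/-- What follows the first number. -/
def dropUnary (l : List Bool) : List Bool := l.drop (unaryLength l + 1)

/-- The state of the reader of strings: the strings read, the letters of the current string, the
current letter, and whether it is within a string and within a letter. -/
abbrev ReadState : Type := List (List ℕ) × (List ℕ × (ℕ × (Bool × Bool)))

/-- Read one bit of a list of strings. -/
def readStep (s : ReadState) (b : Bool) : ReadState :=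
  bif s.2.2.2.2 then
    bif b then (s.1, (s.2.1, (s.2.2.1 + 1, (true, true))))
    else (s.1, (s.2.2.1 :: s.2.1, (0, (true, false))))
  else bif s.2.2.2.1 then
    bif b then (s.1, (s.2.1, (s.2.2.1, (true, true))))
    else (s.2.1.reverse :: s.1, ([], (s.2.2.1, (false, false))))
  else bif b then (s.1, (s.2.1, (s.2.2.1, (true, false)))) else s

/-- Read a list of strings. -/
def readWords (l : List Bool) : List (List ℕ) :=
  (l.foldl readStep ([], ([], (0, (false, false))))).1.reverse

/-- Read the input tape. -/
def parse (l : List Bool) : Data :=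
  (unaryLength l, (unaryLength (dropUnary l), (unaryLength (dropUnary (dropUnary l)),
    (dropUnary (dropUnary (dropUnary l)),
      ((dropUnary (dropUnary (dropUnary l))).drop (unaryLength l),
        readWords (((dropUnary (dropUnary (dropUnary l))).drop (unaryLength l)).drop
          (unaryLength l * (unaryLength (dropUnary l) * unaryLength l))))))))

section

variable {γ : Type} [Enc γ]

theorem unaryStep_foldl_le (l : List Bool) (s : ℕ × Bool) :
    (l.foldl unaryStep s).1 ≤ s.1 + l.length := by
  induction l generalizing s with
  | nil => simp
  | cons b l ih =>
    refine (ih (unaryStep s b)).trans ?_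
    unfold unaryStep
    cases s.2 && b
    · simp
    · simp; omega

@[fun_prop]
theorem pt_unaryLength {l : γ → List Bool} (hl : PT l) : PT fun x => unaryLength (l x) := by
  have h : PT fun x => (l x).foldl unaryStep (0, true) := by
    refine PT.foldl (f := fun _ => unaryStep) (by unfold unaryStep; fun_prop) hl (.const _) ?_
    have h1 : PolyBdd fun x : γ × List Bool => x.2.length :=
      (PT.snd .id).1.mono fun x => length_le_sz x.2
    refine (((PolyBdd.const 2).mul h1).add (.const 5)).mono fun x => ?_
    have h2 := unaryStep_foldl_le x.2 (0, true)
    have h3 := sz_bool (x.2.foldl unaryStep (0, true)).2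
    rw [sz_prod, sz_nat]
    simp only [zero_add] at h2
    omega
  exact h.fst

@[fun_prop]
theorem pt_dropUnary {l : γ → List Bool} (hl : PT l) : PT fun x => dropUnary (l x) := by
  unfold dropUnary
  fun_prop

theorem sz_readStep_le (s : ReadState) (b : Bool) : sz (readStep s b) ≤ sz s + 6 := by
  obtain ⟨ws, w, a, p, q⟩ := s
  have h1 : sz true = 3 := rfl
  have h2 : sz false = 1 := rfl
  cases p <;> cases q <;> cases b <;> simp [readStep, sz_reverse] <;> omega

@[fun_prop]
theorem pt_readWords {l : γ → List Bool} (hl : PT l) : PT fun x => readWords (l x) := by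
  have h : PT fun x => (l x).foldl readStep ([], ([], (0, (false, false)))) := by
    refine PT.foldl (f := fun _ => readStep) (by unfold readStep; fun_prop) hl (.const _) ?_
    have h1 : PolyBdd fun x : γ × List Bool => x.2.length :=
      (PT.snd .id).1.mono fun x => length_le_sz x.2
    have key (l : List Bool) (s : ReadState) :
        sz (l.foldl readStep s) ≤ sz s + 6 * l.length := by
      induction l generalizing s with
      | nil => simp
      | cons b l ih =>
        have h1 := ih (readStep s b)
        have h2 := sz_readStep_le s b
        simp only [List.foldl_cons, List.length_cons]
        omega
    exact ((PolyBdd.const (sz (([], ([], (0, (false, false)))) : ReadState))).add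
      ((PolyBdd.const 6).mul h1)).mono fun x => key _ _
  exact h.fst.reverse

theorem pt_parse : PT parse := by
  unfold parse
  fun_prop

end

/-! ### The vertices of the search graph -/

/-- The two kinds of vertices that are reached. -/
theorem reachable_iff (c : List ℕ × (List ℕ × List ℕ) → Bool) (D : Data) (x : Node) :
    Reachable (succ c D) D.start x ↔ ∃ u z v, u ++ z ++ v ∈ D.2.2.2.2.2 ∧
      ((∃ x₁ : List ℕ, (∀ a ∈ x₁, a < D.2.1) ∧
        x = (false, (u, (z, (v, (x₁.reverse.take z.length, (D.run [D.2.2.1] x₁, []))))))) ∨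
      ∃ x₁ x₂ : List ℕ, (∀ a ∈ x₁, a < D.2.1) ∧ (∀ a ∈ x₂, a < D.2.1) ∧
        c (u.reverse, (z.reverse, x₁.reverse.take z.length)) = true ∧
        x = (true, (u, (z, (v, (x₂.take z.length, (D.run [D.2.2.1] (x₁ ++ (u ++ v) ++ x₂),
          D.run [D.2.2.1] (x₁ ++ (u ++ z ++ v) ++ x₂)))))))) := by
  constructor
  · intro h
    induction h with
    | init hx =>
      simp only [start, List.mem_flatMap, List.mem_map] at hx
      obtain ⟨y, hy, i, -, j, -, rfl⟩ := hx
      exact ⟨y.take i, (y.drop i).take j, (y.drop i).drop j, by simpa using hy,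
        .inl ⟨[], by simp, by simp [run]⟩⟩
    | step _ hy ih =>
      obtain ⟨u, z, v, hw, ⟨x₁, h₁, rfl⟩ | ⟨x₁, x₂, h₁, h₂, hc, rfl⟩⟩ := ih
      · simp only [succ, cond_false, List.mem_append, List.mem_map, List.mem_range] at hy
        rcases hy with ⟨a, ha, rfl⟩ | hy
        · refine ⟨u, z, v, hw, .inl ⟨x₁ ++ [a], ?_, ?_⟩⟩
          · intro b hb
            rcases List.mem_append.1 hb with hb | hb
            · exact h₁ b hb
            · rwa [List.mem_singleton.1 hb]
          · rw [run_append_singleton]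
            rcases z with _ | ⟨z0, z⟩ <;> simp [List.take_take]
        · rcases hc : c (u.reverse, (z.reverse, x₁.reverse.take z.length)) with _ | _
          · simp [hc] at hy
          · rw [hc, cond_true, List.mem_singleton] at hy
            subst hy
            exact ⟨u, z, v, hw, .inr ⟨x₁, [], h₁, by simp, hc, by simp [run_append]⟩⟩
      · simp only [succ, cond_true, List.mem_map, List.mem_range] at hy
        obtain ⟨a, ha, rfl⟩ := hy
        refine ⟨u, z, v, hw, .inr ⟨x₁, x₂ ++ [a], h₁, ?_, hc, ?_⟩⟩
        · intro b hb
          rcases List.mem_append.1 hb with hb | hb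
          · exact h₂ b hb
          · rwa [List.mem_singleton.1 hb]
        · rw [← List.append_assoc _ x₂, ← List.append_assoc _ x₂, run_append_singleton,
            run_append_singleton]
          -- Truncation before appending loses nothing: a full window ignores the new letter, and a
          -- window that is not full has not been truncated.
          have : (x₂.take z.length ++ [a]).take z.length = (x₂ ++ [a]).take z.length := by
            rcases le_total z.length x₂.length with h | h
            · rw [List.take_append_of_le_length (by simp [h]), List.take_append_of_le_length h,
                List.take_take, min_self]
            · rw [List.take_of_length_le h]
          rw [this]
  · rintro ⟨u, z, v, hw, h⟩
    -- Vertices past the site are also reached through these, so this case comes first.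
    have first : ∀ x₁ : List ℕ, (∀ a ∈ x₁, a < D.2.1) → Reachable (succ c D) D.start
        (false, (u, (z, (v, (x₁.reverse.take z.length, (D.run [D.2.2.1] x₁, [])))))) := by
      intro x₁
      induction x₁ using List.reverseRecOn with
      | nil =>
        intro _
        refine .init ?_
        simp only [start, List.mem_flatMap, List.mem_map, List.mem_range]
        refine ⟨u ++ z ++ v, hw, u.length, by simp, z.length, by simp; omega, ?_⟩
        simp [run]
      | append_singleton x₁ a ih =>
        intro ha
        refine .step (ih fun b hb => ha b (by simp [hb])) ?_
        simp only [succ, cond_false, List.mem_append, List.mem_map, List.mem_range]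
        refine .inl ⟨a, ha a (by simp), ?_⟩
        rw [run_append_singleton]
        rcases z with _ | ⟨z0, z⟩ <;> simp [List.take_take]
    rcases h with ⟨x₁, h₁, rfl⟩ | ⟨x₁, x₂, h₁, h₂, hc, rfl⟩
    · exact first x₁ h₁
    · induction x₂ using List.reverseRecOn with
      | nil =>
        refine .step (first x₁ h₁) ?_
        simp only [succ, cond_false, List.mem_append, hc, cond_true, List.mem_singleton]
        right
        simp [run_append]
      | append_singleton x₂ a ih =>
        refine .step (ih fun b hb => h₂ b (by simp [hb])) ?_
        simp only [succ, cond_true, List.mem_map, List.mem_range]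
        refine ⟨a, h₂ a (by simp), ?_⟩
        rw [← List.append_assoc _ x₂, ← List.append_assoc _ x₂, run_append_singleton,
          run_append_singleton]
        have : (x₂.take z.length ++ [a]).take z.length = (x₂ ++ [a]).take z.length := by
          rcases le_total z.length x₂.length with h | h
          · rw [List.take_append_of_le_length (by simp [h]), List.take_append_of_le_length h,
              List.take_take, min_self]
          · rw [List.take_of_length_le h]
        rw [this]

/-! ### A finite set containing the reachable vertices -/

/-- The strings of length at most `m` over the first `k` letters. -/
def boundedWords (k : ℕ) : ℕ → Finset (List ℕ)
  | 0 => {[]}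
  | m + 1 => insert [] ((Finset.range k ×ˢ boundedWords k m).image fun x => x.1 :: x.2)

/-- Each of the `m` places holds one of `k` letters or nothing. -/
theorem card_boundedWords_le (k m : ℕ) : (boundedWords k m).card ≤ (k + 1) ^ m := by
  induction m with
  | zero => simp [boundedWords]
  | succ m ih =>
    refine (Finset.card_insert_le _ _).trans ((Nat.add_le_add_right Finset.card_image_le 1).trans ?_)
    rw [Finset.card_product, Finset.card_range]
    have h1 : k * (boundedWords k m).card ≤ k * (k + 1) ^ m := by gcongr
    have h2 : 1 ≤ (k + 1) ^ m := Nat.one_le_pow _ _ (Nat.succ_pos _)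
    rw [pow_succ, mul_add_one, mul_comm _ k]
    omega

theorem mem_boundedWords {k m : ℕ} {l : List ℕ} (h : ∀ a ∈ l, a < k) (hl : l.length ≤ m) :
    l ∈ boundedWords k m := by
  induction m generalizing l with
  | zero => simpa [boundedWords] using hl
  | succ m ih =>
    rcases l with _ | ⟨a, l⟩
    · simp [boundedWords]
    · refine Finset.mem_insert_of_mem (Finset.mem_image.2 ⟨(a, l), ?_, rfl⟩)
      rw [Finset.mem_product, Finset.mem_range]
      exact ⟨h a List.mem_cons_self, ih (fun b hb => h b (List.mem_cons_of_mem _ hb))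
        (by simpa using hl)⟩

theorem sz_boundedWord {k m : ℕ} {l : List ℕ} (h : ∀ a ∈ l, a < k) (hl : l.length ≤ m) :
    sz l ≤ m * (2 * k + 2) + 1 := by
  refine (sz_le_of_forall_le (B := 2 * k + 1) fun a ha => ?_).trans (by gcongr)
  rw [sz_nat]
  have := h a ha
  omega

/-- A finite set that contains all vertices, when `SS` contains all sets of states. -/
def nodes (k m : ℕ) (SS : Finset (List ℕ)) : Finset Node :=
  Finset.univ ×ˢ (boundedWords k m ×ˢ (boundedWords k m ×ˢ (boundedWords k m ×ˢ
    (boundedWords k m ×ˢ (SS ×ˢ SS)))))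

theorem card_nodes_le (k m : ℕ) (SS : Finset (List ℕ)) :
    (nodes k m SS).card ≤ 2 * ((k + 1) ^ m * ((k + 1) ^ m * ((k + 1) ^ m * ((k + 1) ^ m *
      (SS.card * SS.card))))) := by
  have := card_boundedWords_le k m
  simp only [nodes, Finset.card_product]
  gcongr
  exact le_rfl

/-- The family `SS` is left open, so that it can be all sets of states or, for a deterministic
automaton, the small ones. It must contain `[]`, the idle second set before the site. The size bound
counts four strings, two sets of states, at most 3 for the truth value and 6 for the pairs. -/
theorem mem_nodes (c : List ℕ × (List ℕ × List ℕ) → Bool) (D : Data) (m : ℕ)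
    (SS : Finset (List ℕ)) (hm : ∀ w ∈ D.2.2.2.2.2, w.length ≤ m ∧ ∀ a ∈ w, a < D.2.1)
    (h0 : [] ∈ SS) (h1 : [D.2.2.1] ∈ SS) (h2 : ∀ S ∈ SS, ∀ a < D.2.1, D.next S a ∈ SS)
    (h3 : ∀ S ∈ SS, S.Sublist (List.range D.1)) (x : Node) (hx : Reachable (succ c D) D.start x) :
    x ∈ nodes D.2.1 m SS ∧ sz x ≤ 4 * (m * (2 * D.2.1 + 2) + 1) +
      2 * (D.1 * (2 * D.1 + 2) + 1) + 9 := by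
  have hrun : ∀ w : List ℕ, (∀ a ∈ w, a < D.2.1) → D.run [D.2.2.1] w ∈ SS := by
    intro w
    induction w using List.reverseRecOn with
    | nil => exact fun _ => h1
    | append_singleton w a ih =>
      intro hw
      rw [run_append_singleton]
      exact h2 _ (ih fun b hb => hw b (by simp [hb])) a (hw a (by simp))
  have hsz : ∀ S ∈ SS, sz S ≤ D.1 * (2 * D.1 + 2) + 1 := fun S hS => sz_sublist_range (h3 S hS)
  have key : ∀ (ph : Bool) (u z v p S T : List ℕ), u ++ z ++ v ∈ D.2.2.2.2.2 →
      p.length ≤ z.length → (∀ a ∈ p, a < D.2.1) → S ∈ SS → T ∈ SS →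
      (ph, (u, (z, (v, (p, (S, T)))))) ∈ nodes D.2.1 m SS ∧
      sz (ph, (u, (z, (v, (p, (S, T)))))) ≤ 4 * (m * (2 * D.2.1 + 2) + 1) +
        2 * (D.1 * (2 * D.1 + 2) + 1) + 9 := by
    intro ph u z v p S T hw hp hpk hS hT
    obtain ⟨hl, hk⟩ := hm _ hw
    simp only [List.length_append] at hl
    have hu : (∀ a ∈ u, a < D.2.1) ∧ u.length ≤ m := ⟨fun a ha => hk a (by simp [ha]), by omega⟩
    have hz : (∀ a ∈ z, a < D.2.1) ∧ z.length ≤ m := ⟨fun a ha => hk a (by simp [ha]), by omega⟩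
    have hv : (∀ a ∈ v, a < D.2.1) ∧ v.length ≤ m := ⟨fun a ha => hk a (by simp [ha]), by omega⟩
    have hp' : (∀ a ∈ p, a < D.2.1) ∧ p.length ≤ m := ⟨hpk, by omega⟩
    constructor
    · simp only [nodes, Finset.mem_product, Finset.mem_univ, true_and]
      exact ⟨mem_boundedWords hu.1 hu.2, mem_boundedWords hz.1 hz.2, mem_boundedWords hv.1 hv.2,
        mem_boundedWords hp'.1 hp'.2, hS, hT⟩
    · have e1 := sz_boundedWord hu.1 hu.2
      have e2 := sz_boundedWord hz.1 hz.2
      have e3 := sz_boundedWord hv.1 hv.2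
      have e4 := sz_boundedWord hp'.1 hp'.2
      have e5 := hsz S hS
      have e6 := hsz T hT
      have e7 := sz_bool ph
      simp only [sz_pair]
      omega
  obtain ⟨u, z, v, hw, ⟨x₁, k₁, rfl⟩ | ⟨x₁, x₂, k₁, k₂, -, rfl⟩⟩ := (reachable_iff c D x).1 hx
  · exact key _ _ _ _ _ _ _ hw (by simp) (fun a ha => k₁ a (by simpa using List.mem_of_mem_take ha))
      (hrun _ k₁) h0
  · have hk := (hm _ hw).2
    refine key _ _ _ _ _ _ _ hw (by simp) (fun a ha => k₂ a (List.mem_of_mem_take ha))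
      (hrun _ fun a ha => ?_) (hrun _ fun a ha => ?_)
    · simp only [List.mem_append] at ha hk
      rcases ha with (ha | ha) | ha
      · exact k₁ a ha
      · exact hk a (by tauto)
      · exact k₂ a ha
    · simp only [List.mem_append] at ha hk
      rcases ha with (ha | ha) | ha
      · exact k₁ a ha
      · exact hk a (by tauto)
      · exact k₂ a ha

/-! ### The data of an input -/

theorem unaryStep_foldl_false (l : List Bool) (n : ℕ) :
    l.foldl unaryStep (n, false) = (n, false) := by
  induction l with
  | nil => rfl
  | cons b l ih => exact ih

theorem unaryLength_unary (n : ℕ) (r : List Bool) :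
    unaryLength (SDIInput.unary n ++ r) = n := by
  have key (m : ℕ) : (List.replicate n true).foldl unaryStep (m, true) = (m + n, true) := by
    induction n generalizing m with
    | zero => rfl
    | succ n ih =>
      rw [List.replicate_succ, List.foldl_cons]
      refine (ih (m + 1)).trans ?_
      rw [add_right_comm, add_assoc]
  rw [unaryLength, SDIInput.unary, List.foldl_append, List.foldl_append, key, List.foldl_cons,
    List.foldl_nil]
  have : unaryStep (0 + n, true) false = (n, false) := by simp [unaryStep]
  rw [this, unaryStep_foldl_false]

theorem dropUnary_unary (n : ℕ) (r : List Bool) :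
    dropUnary (SDIInput.unary n ++ r) = r := by
  rw [dropUnary, unaryLength_unary]
  exact List.drop_left' (by simp [SDIInput.unary])

theorem readStep_foldl_letter (ws : List (List ℕ)) (w : List ℕ) (m n : ℕ) :
    (SDIInput.unary n).foldl readStep (ws, (w, (m, (true, true)))) =
      (ws, ((m + n) :: w, (0, (true, false)))) := by
  induction n generalizing m with
  | zero => rfl
  | succ n ih =>
    rw [SDIInput.unary, List.replicate_succ, List.cons_append, List.foldl_cons]
    refine (ih (m + 1)).trans ?_
    rw [add_right_comm, add_assoc]

theorem readStep_foldl_word {k : ℕ} (ws : List (List ℕ)) (w : List ℕ) (y : List (Fin k)) :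
    (SDIInput.encodeWord y).foldl readStep (ws, (w, (0, (true, false)))) =
      ((w.reverse ++ y.map Fin.val) :: ws, ([], (0, (false, false)))) := by
  have e : SDIInput.encodeWord y =
      (y.map Fin.val).flatMap (fun a => true :: SDIInput.unary a) ++ [false] := by
    simp [SDIInput.encodeWord, List.flatMap_map, List.flatMap_assoc]
  rw [e]
  generalize y.map Fin.val = y
  induction y generalizing w with
  | nil => simp [readStep]
  | cons a y ih =>
    rw [List.flatMap_cons, List.append_assoc, List.foldl_append, List.foldl_cons]
    have h : readStep (ws, (w, (0, (true, false)))) true = (ws, (w, (0, (true, true)))) := rfl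
    rw [h, readStep_foldl_letter, ih]
    simp

/-- Outside a string the reader ignores `false`, so the closing bit of the tape has no effect. -/
theorem readWords_encode {k : ℕ} (ys : List (List (Fin k))) :
    readWords (ys.flatMap (fun w => true :: SDIInput.encodeWord w) ++ [false]) =
      ys.map (List.map Fin.val) := by
  have key (ws : List (List ℕ)) :
      (ys.flatMap (fun w => true :: SDIInput.encodeWord w)).foldl readStep
        (ws, ([], (0, (false, false)))) =
      ((ys.map (List.map Fin.val)).reverse ++ ws, ([], (0, (false, false)))) := by
    induction ys generalizing ws with
    | nil => rfl
    | cons y ys ih =>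
      rw [List.flatMap_cons, List.foldl_append, List.foldl_cons]
      have h : readStep (ws, ([], (0, (false, false)))) true = (ws, ([], (0, (true, false)))) := rfl
      rw [h, readStep_foldl_word, ih]
      simp
  rw [readWords, List.foldl_append, key]
  simp [readStep]

/-- Addressing in a table of rows of equal length; `r` is whatever follows the table. -/
theorem getD_flatMap {α β : Type} (l : List α) (f : α → List β) (m : ℕ)
    (hf : ∀ a ∈ l, (f a).length = m) (r : List β) (i j : ℕ) (hi : i < l.length) (hj : j < m) (d : β) :
    (l.flatMap f ++ r).getD (i * m + j) d = (f l[i]).getD j d := by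
  induction l generalizing i with
  | nil => simp at hi
  | cons a l ih =>
    have ha := hf a List.mem_cons_self
    rw [List.flatMap_cons, List.append_assoc]
    rcases i with _ | i
    · rw [zero_mul, zero_add, List.getD_append _ _ _ _ (by omega)]
      rfl
    · rw [List.getD_append_right _ _ _ _ (by rw [ha, add_mul]; omega), ha, add_mul, one_mul,
        add_right_comm, Nat.add_sub_cancel]
      exact ih (fun b hb => hf b (List.mem_cons_of_mem _ hb)) i (by simpa using hi)

end Data

open Data

variable (I : SDIInput)

/-- The two tables are not cut off at their ends, so nothing is claimed about their entries beyond
the genuine states and letters. -/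
theorem parse_encode : ∃ fin tbl : List Bool, parse I.encode =
    (I.numStates, (I.numLetters, ((I.start : ℕ), (fin, (tbl, I.words.map (List.map Fin.val)))))) ∧
    (∀ q : Fin I.numStates, fin.getD q false = I.final q) ∧
    ∀ (q : Fin I.numStates) (a : Fin I.numLetters) (r : Fin I.numStates),
      tbl.getD ((q * I.numLetters + a) * I.numStates + r) false = I.trans q a r := by
  obtain ⟨ws, hws⟩ : ∃ ws, ws = I.words.flatMap (fun w => true :: SDIInput.encodeWord w) ++ [false] :=
    ⟨_, rfl⟩
  obtain ⟨tb, htb⟩ : ∃ tb, tb = (List.finRange I.numStates).flatMap (fun q =>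
    (List.finRange I.numLetters).flatMap (fun a =>
      (List.finRange I.numStates).map (fun r => I.trans q a r))) := ⟨_, rfl⟩
  obtain ⟨fi, hfi⟩ : ∃ fi, fi = (List.finRange I.numStates).map I.final := ⟨_, rfl⟩
  have he : I.encode = SDIInput.unary I.numStates ++ (SDIInput.unary I.numLetters ++
      (SDIInput.unary I.start ++ (fi ++ (tb ++ ws)))) := by
    simp only [SDIInput.encode, hws, htb, hfi, List.append_assoc]
  have hfil : fi.length = I.numStates := by simp [hfi]
  have hin : ∀ q : Fin I.numStates, ((List.finRange I.numLetters).flatMap (fun a =>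
      (List.finRange I.numStates).map (fun r => I.trans q a r))).length =
      I.numLetters * I.numStates := fun q => by simp
  have htbl : tb.length = I.numStates * (I.numLetters * I.numStates) := by
    simp [htb]
  refine ⟨fi ++ (tb ++ ws), tb ++ ws, ?_, fun q => ?_, fun q a r => ?_⟩
  · rw [he, parse]
    simp only [unaryLength_unary, dropUnary_unary]
    rw [List.drop_left' hfil, List.drop_left' htbl, hws, readWords_encode]
  · rw [List.getD_append _ _ _ _ (by rw [hfil]; exact q.2), hfi,
      List.getD_eq_getElem _ _ (by simp)]
    simp
  · have e : ((q : ℕ) * I.numLetters + a) * I.numStates + r =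
        q * (I.numLetters * I.numStates) + (a * I.numStates + r) := by ring
    have h1 : (a : ℕ) * I.numStates + r < I.numLetters * I.numStates := by
      have h2 : (a + 1 : ℕ) * I.numStates ≤ I.numLetters * I.numStates := by
        gcongr
        exact a.2
      have := r.2
      rw [add_mul] at h2
      omega
    rw [e, htb, getD_flatMap _ _ _ (fun q _ => hin q) ws q _ (by simp) h1]
    have h3 := getD_flatMap (List.finRange I.numLetters) (fun a =>
      (List.finRange I.numStates).map (fun r => I.trans q a r)) I.numStates (by simp) [] a r
      (by simp) r.2 false
    rw [List.append_nil] at h3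
    simp only [List.getElem_finRange, Fin.cast_mk, Fin.eta] at h3 ⊢
    rw [h3, List.getD_eq_getElem _ _ (by simp)]
    simp

/-! ### Correctness of the simulation of the automaton -/

/-- A list of numbers represents a set of states. -/
def Represents {n : ℕ} (S : List ℕ) (s : Set (Fin n)) : Prop :=
  ∀ q : ℕ, q ∈ S ↔ ∃ h : q < n, (⟨q, h⟩ : Fin n) ∈ s

theorem represents_next {S : List ℕ} {s : Set (Fin I.numStates)} (h : Represents S s)
    (a : Fin I.numLetters) :
    Represents ((parse I.encode).next S a) (I.toNFA.stepSet s a) := by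
  obtain ⟨fin, tbl, hp, -, ht⟩ := parse_encode I
  rw [hp]
  intro r
  simp only [next, List.mem_filter, List.mem_range, List.any_eq_true, NFA.mem_stepSet]
  constructor
  · rintro ⟨hr, q, hq, hqr⟩
    obtain ⟨hq', hqs⟩ := (h q).1 hq
    exact ⟨hr, ⟨q, hq'⟩, hqs, (ht ⟨q, hq'⟩ a ⟨r, hr⟩).symm.trans hqr⟩
  · rintro ⟨hr, q, hqs, hqr⟩
    exact ⟨hr, q, (h q).2 ⟨q.2, hqs⟩, (ht q a ⟨r, hr⟩).trans hqr⟩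

theorem represents_run (w : List (Fin I.numLetters)) :
    Represents ((parse I.encode).run [(parse I.encode).2.2.1] (w.map Fin.val))
      (I.toNFA.eval w) := by
  induction w using List.reverseRecOn with
  | nil =>
    obtain ⟨fin, tbl, hp, -, -⟩ := parse_encode I
    rw [hp]
    intro q
    simp only [run, List.map_nil, List.foldl_nil, List.mem_singleton, NFA.eval_nil]
    exact ⟨fun h => ⟨h ▸ I.start.2, Fin.ext h⟩, fun ⟨_, h⟩ => congrArg Fin.val h⟩
  | append_singleton w a ih =>
    rw [List.map_append, List.map_singleton, run_append_singleton, NFA.eval_append_singleton]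
    exact represents_next I ih a

theorem accepting_run (w : List (Fin I.numLetters)) :
    (parse I.encode).accepting ((parse I.encode).run [(parse I.encode).2.2.1] (w.map Fin.val)) =
      true ↔ w ∈ I.R := by
  have hr := represents_run I w
  generalize (parse I.encode).run [(parse I.encode).2.2.1] (w.map Fin.val) = S at hr
  obtain ⟨fin, tbl, hp, hf, -⟩ := parse_encode I
  rw [hp, accepting, List.any_eq_true, SDIInput.R, NFA.mem_accepts]
  constructor
  · rintro ⟨q, hq, hqf⟩
    obtain ⟨hq', hqs⟩ := (hr q).1 hq
    exact ⟨⟨q, hq'⟩, (hf ⟨q, hq'⟩).symm.trans hqf, hqs⟩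
  · rintro ⟨q, hqf, hqs⟩
    exact ⟨q, (hr q).2 ⟨q.2, hqs⟩, (hf q).trans hqf⟩

/-! ### Bounds for the number of vertices -/

theorem exists_nodes (c : List ℕ × (List ℕ × List ℕ) → Bool) (m : ℕ) (SS : Finset (List ℕ))
    (hm : ∀ w ∈ I.F, w.length ≤ m)
    (h0 : [] ∈ SS) (h1 : [(I.start : ℕ)] ∈ SS)
    (h2 : ∀ S ∈ SS, ∀ a < I.numLetters, (parse I.encode).next S a ∈ SS)
    (h3 : ∀ S ∈ SS, S.Sublist (List.range I.numStates)) (x : Node)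
    (hx : Reachable (succ c (parse I.encode)) (parse I.encode).start x) :
    x ∈ nodes I.numLetters m SS ∧ sz x ≤ 4 * (m * (2 * I.numLetters + 2) + 1) +
      2 * (I.numStates * (2 * I.numStates + 2) + 1) + 9 := by
  have h := mem_nodes c (parse I.encode) m SS
  obtain ⟨fin, tbl, hp, -, -⟩ := parse_encode I
  have hn : (parse I.encode).1 = I.numStates := by rw [hp]
  have hk : (parse I.encode).2.1 = I.numLetters := by rw [hp]
  have hs : (parse I.encode).2.2.1 = I.start := by rw [hp]
  have hw : (parse I.encode).2.2.2.2.2 = I.words.map (List.map Fin.val) := by rw [hp]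
  rw [hn, hk, hs, hw] at h
  refine h ?_ h0 h1 h2 h3 x hx
  simp only [List.mem_map]
  rintro _ ⟨w, hw, rfl⟩
  refine ⟨by simpa using hm w hw, fun a ha => ?_⟩
  obtain ⟨b, -, rfl⟩ := List.mem_map.1 ha
  exact b.2

theorem next_sublist (S : List ℕ) (a : ℕ) :
    ((parse I.encode).next S a).Sublist (List.range I.numStates) := by
  obtain ⟨fin, tbl, hp, -, -⟩ := parse_encode I
  rw [hp]
  exact List.filter_sublist

theorem singleton_sublist_range {n q : ℕ} (h : q < n) : [q].Sublist (List.range n) :=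
  List.singleton_sublist.2 (List.mem_range.2 h)

/-- Sets of states are kept as increasing lists, so all sublists of the range of states suffice.
Their number is exponential, which is harmless for termination. -/
theorem exists_finite_nodes (c : List ℕ × (List ℕ × List ℕ) → Bool) :
    ∃ (U : Finset Node) (B : ℕ), ∀ x,
      Reachable (succ c (parse I.encode)) (parse I.encode).start x → x ∈ U ∧ sz x ≤ B := by
  obtain ⟨m, hm⟩ : ∃ m, ∀ w ∈ I.F, w.length ≤ m :=
    ⟨(I.words.map List.length).sum, fun w hw =>
      List.single_le_sum (fun _ _ => Nat.zero_le _) _ (List.mem_map_of_mem hw)⟩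
  have hmem (S : List ℕ) : S ∈ (List.range I.numStates).sublists.toFinset ↔
      S.Sublist (List.range I.numStates) := by simp
  exact ⟨_, _, exists_nodes I c m (List.range I.numStates).sublists.toFinset hm
    ((hmem _).2 (List.nil_sublist _)) ((hmem _).2 (singleton_sublist_range I.start.2))
    (fun S _ a _ => (hmem _).2 (next_sublist I S a)) fun S hS => (hmem S).1 hS⟩

theorem next_deterministic (hI : I.Deterministic) {q a : ℕ} (hq : q < I.numStates)
    (ha : a < I.numLetters) : ((parse I.encode).next [q] a).length ≤ 1 := by
  obtain ⟨fin, tbl, hp, -, ht⟩ := parse_encode I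
  have hnd : ((parse I.encode).next [q] a).Nodup := List.Nodup.filter _ List.nodup_range
  have hmem : ∀ r ∈ (parse I.encode).next [q] a, ∃ h : r < I.numStates,
      (⟨r, h⟩ : Fin I.numStates) ∈ I.toNFA.step ⟨q, hq⟩ ⟨a, ha⟩ := by
    rw [hp]
    intro r hr
    simp only [next, List.mem_filter, List.mem_range, List.any_cons, List.any_nil,
      Bool.or_false] at hr
    exact ⟨hr.1, (ht ⟨q, hq⟩ ⟨a, ha⟩ ⟨r, hr.1⟩).symm.trans hr.2⟩
  generalize (parse I.encode).next [q] a = L at hnd hmem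
  rcases L with _ | ⟨r, _ | ⟨r', L⟩⟩
  · simp
  · simp
  · obtain ⟨h, hr⟩ := hmem r (by simp)
    obtain ⟨h', hr'⟩ := hmem r' (by simp)
    have e : r = r' := congrArg Fin.val (hI _ _ hr hr')
    simp [e] at hnd

/-- Both numbers stand in unary on the tape. -/
theorem numStates_add_numLetters_le : I.numStates + I.numLetters ≤ I.encode.length := by
  simp only [SDIInput.encode, SDIInput.unary, List.length_append, List.length_replicate]
  omega

/-- Determinism keeps the reached sets of states within the empty set and the singletons, a family
closed under `next`. For fixed `m` the number of strings is a polynomial in the number of letters,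
with `m` as exponent. -/
theorem exists_poly_nodes (c : List ℕ × (List ℕ × List ℕ) → Bool) (m : ℕ) :
    ∃ q : Polynomial ℕ, ∀ I : SDIInput, I.Deterministic → (∀ w ∈ I.F, w.length ≤ m) →
      ∃ (U : Finset Node) (B : ℕ),
      (∀ x, Reachable (succ c (parse I.encode)) (parse I.encode).start x → x ∈ U ∧ sz x ≤ B) ∧
      U.card * (B + 1) ≤ q.eval I.encode.length := by
  let X : Polynomial ℕ := Polynomial.X
  refine ⟨2 * ((X + 1) ^ m * ((X + 1) ^ m * ((X + 1) ^ m * ((X + 1) ^ m * ((X + 1) * (X + 1)))))) *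
    (4 * (Polynomial.C m * (2 * X + 2) + 1) + 2 * (X * (2 * X + 2) + 1) + 9 + 1),
    fun I hI hm => ?_⟩
  have hlen := numStates_add_numLetters_le I
  have hmem (S : List ℕ) :
      S ∈ insert [] ((Finset.range I.numStates).image fun q => [q]) ↔
        S = [] ∨ ∃ q < I.numStates, [q] = S := by
    simp
  have hcard : (insert ([] : List ℕ)
      ((Finset.range I.numStates).image fun q => [q])).card ≤ I.numStates + 1 :=
    (Finset.card_insert_le _ _).trans (Nat.add_le_add_right
      (Finset.card_image_le.trans (Finset.card_range _).le) 1)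
  generalize insert ([] : List ℕ) ((Finset.range I.numStates).image fun q => [q]) = SS
    at hmem hcard
  refine ⟨_, _, exists_nodes I c m SS hm ((hmem _).2 (.inl rfl))
    ((hmem _).2 (.inr ⟨_, I.start.2, rfl⟩)) ?_ ?_, ?_⟩
  · intro S hS a ha
    rw [hmem]
    rcases (hmem S).1 hS with rfl | ⟨q, hq, rfl⟩
    · simp [next]
    · have h1 := next_deterministic I hI hq ha
      have h2 := next_sublist I [q] a
      generalize (parse I.encode).next [q] a = L at h1 h2
      rcases L with _ | ⟨r, _ | ⟨r', L⟩⟩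
      · exact .inl rfl
      · exact .inr ⟨r, List.mem_range.1 (List.singleton_sublist.1 h2), rfl⟩
      · simp at h1
  · intro S hS
    rcases (hmem S).1 hS with rfl | ⟨q, hq, rfl⟩
    · exact List.nil_sublist _
    · exact singleton_sublist_range hq
  · simp only [X, Polynomial.eval_add, Polynomial.eval_mul, Polynomial.eval_pow, Polynomial.eval_X,
      Polynomial.eval_one, Polynomial.eval_ofNat, Polynomial.eval_C]
    refine Nat.mul_le_mul ((card_nodes_le _ _ _).trans ?_) ?_
    · have h1 : I.numLetters + 1 ≤ I.encode.length + 1 := by omega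
      have h2 : SS.card ≤ I.encode.length + 1 := by omega
      gcongr
    · have h1 : I.numLetters ≤ I.encode.length := by omega
      have h2 : I.numStates ≤ I.encode.length := by omega
      gcongr

/-! ### Correctness of the search -/

/-- By `hc` the condition does not look beyond `z.length` letters, so the windows stored in the
vertices decide it for the full contexts. -/
theorem search_iff (c : List ℕ × (List ℕ × List ℕ) → Bool)
    (hc : ∀ v z s, c (v, (z, s.take z.length)) = c (v, (z, s))) :
    (∃ x, Reachable (succ c (parse I.encode)) (parse I.encode).start x ∧
      bad c (parse I.encode) x = true) ↔
    ∃ u z v x₁ x₂ : List (Fin I.numLetters), u ++ z ++ v ∈ I.words ∧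
      c ((u.map Fin.val).reverse, ((z.map Fin.val).reverse, (x₁.map Fin.val).reverse)) = true ∧
      c (v.map Fin.val, (z.map Fin.val, x₂.map Fin.val)) = true ∧
      x₁ ++ (u ++ v) ++ x₂ ∈ I.R ∧ x₁ ++ (u ++ z ++ v) ++ x₂ ∉ I.R := by
  have hlift (l : List ℕ) (h : ∀ a ∈ l, a < I.numLetters) :
      ∃ w : List (Fin I.numLetters), l = w.map Fin.val :=
    ⟨l.pmap Fin.mk h, by simp [List.map_pmap]⟩
  obtain ⟨fin, tbl, hp, -, -⟩ := parse_encode I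
  have hk : (parse I.encode).2.1 = I.numLetters := by rw [hp]
  have hw : (parse I.encode).2.2.2.2.2 = I.words.map (List.map Fin.val) := by rw [hp]
  simp only [reachable_iff, hk, hw, List.mem_map]
  constructor
  · rintro ⟨x, ⟨u', z', v', ⟨y, hy, hy'⟩, ⟨x₁, k₁, rfl⟩ | ⟨x₁, x₂, k₁, k₂, hcu, rfl⟩⟩, hb⟩
    · simp [bad] at hb
    · obtain ⟨x₁, rfl⟩ := hlift x₁ k₁
      obtain ⟨x₂, rfl⟩ := hlift x₂ k₂
      obtain ⟨t, v, rfl, ht, rfl⟩ := List.map_eq_append_iff.1 hy'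
      obtain ⟨u, z, rfl, rfl, rfl⟩ := List.map_eq_append_iff.1 ht
      simp only [bad, Bool.true_and, Bool.and_eq_true, Bool.not_eq_true', ← List.map_append,
        hc, accepting_run, ← Bool.not_eq_true] at hb
      -- On the left the middle part is reversed; `hc` applies once the window length is written as
      -- that of the reversal.
      rw [← List.length_reverse (as := z.map Fin.val), hc] at hcu
      exact ⟨u, z, v, x₁, x₂, hy, hcu, hb⟩
  · rintro ⟨u, z, v, x₁, x₂, hy, h1, h2, h3, h4⟩
    refine ⟨_, ⟨u.map Fin.val, z.map Fin.val, v.map Fin.val, ⟨_, hy, by simp⟩,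
      .inr ⟨x₁.map Fin.val, x₂.map Fin.val, by simp, by simp, ?_, rfl⟩⟩, ?_⟩
    · rw [← List.length_reverse (as := z.map Fin.val), hc]
      exact h1
    · simp only [bad, Bool.true_and, Bool.and_eq_true, Bool.not_eq_true', ← List.map_append,
        hc, accepting_run, ← Bool.not_eq_true]
      exact ⟨h2, h3, h4⟩

/-- The common core of both problems: an operation enters only through a one-sided condition `c`,
applied to the right of the site and, reversed, to the left. -/
theorem decidableAndPolyTime_of_condition (c : List ℕ × (List ℕ × List ℕ) → Bool) (hpt : PT c)
    (hc : ∀ v z s, c (v, (z, s.take z.length)) = c (v, (z, s))) (P : SDIInput → Prop)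
    (hP : ∀ I : SDIInput, P I ↔ ¬ ∃ u z v x₁ x₂ : List (Fin I.numLetters), u ++ z ++ v ∈ I.words ∧
      c ((u.map Fin.val).reverse, ((z.map Fin.val).reverse, (x₁.map Fin.val).reverse)) = true ∧
      c (v.map Fin.val, (z.map Fin.val, x₂.map Fin.val)) = true ∧
      x₁ ++ (u ++ v) ++ x₂ ∈ I.R ∧ x₁ ++ (u ++ z ++ v) ++ x₂ ∉ I.R) :
    DecidableAndPolyTimeOnBoundedDFA P :=
  decidableAndPolyTime_of_search pt_parse (pt_succ hpt) (pt_bad hpt) pt_start P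
    (fun I => by rw [hP, search_iff I c hc]) (fun I => exists_finite_nodes I c)
    (exists_poly_nodes c)

/-! ### The conditions on one side of the site -/

section

variable {α : Type} [DecidableEq α]

/-- The condition of maximal site-directed insertion on the right-hand side `s` of the site, for
the inserted string `u ++ z ++ v`; by reversal also the condition on the left-hand side. -/
def siteMax (v z s : List α) : Bool :=
  !v.isEmpty && (List.range s.length).all fun i =>
    !decide (v ++ s.take (i + 1) =
      (z ++ v).drop ((z ++ v).length - (v ++ s.take (i + 1)).length))

/-- The condition of minimal site-directed insertion on `v`. -/
def siteMin (v : List α) : Bool :=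
  !v.isEmpty && (List.range v.length).all fun i =>
    decide (i = 0) || !decide (v.take i = v.drop (v.length - i))

theorem siteMax_iff {v z s : List α} : siteMax v z s = true ↔
    v ≠ [] ∧ ∀ t, t ≠ [] → t <+: s → ¬ v ++ t <:+ z ++ v := by
  simp only [siteMax, Bool.and_eq_true, Bool.not_eq_true', List.isEmpty_eq_false_iff,
    List.all_eq_true, List.mem_range, decide_eq_false_iff_not, ← List.suffix_iff_eq_drop]
  refine and_congr_right fun _ => ⟨fun h t ht hts => ?_, fun h i hi => h _ ?_ (List.take_prefix _ _)⟩
  · have h1 := List.length_pos_iff.2 ht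
    have h2 := hts.length_le
    -- The test runs over `s.take (i + 1)`, that is, over the nonempty prefixes.
    have h3 := h (t.length - 1) (by omega)
    rwa [Nat.sub_add_cancel h1, ← List.prefix_iff_eq_take.1 hts] at h3
  · rw [← List.length_pos_iff, List.length_take]
    omega

theorem siteMin_iff {v : List α} : siteMin v = true ↔
    v ≠ [] ∧ ¬ ∃ s : List α, s ≠ [] ∧ s ≠ v ∧ s <+: v ∧ s <:+ v := by
  simp only [siteMin, Bool.and_eq_true, Bool.not_eq_true', List.isEmpty_eq_false_iff,
    List.all_eq_true, List.mem_range, Bool.or_eq_true, decide_eq_true_eq, decide_eq_false_iff_not]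
  refine and_congr_right fun _ => ⟨?_, fun h i hi => ?_⟩
  · rintro h ⟨s, hs, hsv, hp, hq⟩
    have h1 := List.length_pos_iff.2 hs
    have h2 : s.length < v.length :=
      lt_of_le_of_ne hp.length_le fun e => hsv (hp.eq_of_length e)
    rcases h s.length h2 with h3 | h3
    · omega
    · exact h3 ((List.prefix_iff_eq_take.1 hp).symm.trans (List.suffix_iff_eq_drop.1 hq))
  · by_contra! hc
    refine h ⟨v.take i, ?_, fun e => ?_, List.take_prefix _ _, ?_⟩
    · rw [← List.length_pos_iff, List.length_take]
      omega
    · have := congrArg List.length e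
      rw [List.length_take] at this
      omega
    · rw [hc.2]
      exact List.drop_suffix _ _

/-- A suffix `v ++ t` of `z ++ v` has `t.length ≤ z.length`, so longer prefixes of `s` cannot
violate the condition. -/
theorem siteMax_take (v z s : List α) : siteMax v z (s.take z.length) = siteMax v z s := by
  rw [Bool.eq_iff_iff, siteMax_iff, siteMax_iff]
  refine and_congr_right fun _ => ⟨fun h t ht hts hv => h t ht ?_ hv, fun h t ht hts =>
    h t ht (hts.trans (List.take_prefix _ _))⟩
  have := hv.length_le
  simp only [List.length_append] at this
  rw [List.prefix_take_iff]
  exact ⟨hts, by omega⟩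

theorem siteMax_map {β : Type} [DecidableEq β] {f : α → β} (hf : Function.Injective f)
    (v z s : List α) : siteMax (v.map f) (z.map f) (s.map f) = siteMax v z s := by
  simp only [siteMax, List.isEmpty_map, List.length_map, ← List.map_take, ← List.map_append,
    ← List.map_drop, (List.map_injective_iff.2 hf).eq_iff]

theorem siteMin_map {β : Type} [DecidableEq β] {f : α → β} (hf : Function.Injective f)
    (v : List α) : siteMin (v.map f) = siteMin v := by
  simp only [siteMin, List.isEmpty_map, List.length_map, ← List.map_take,
    ← List.map_drop, (List.map_injective_iff.2 hf).eq_iff]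

theorem pt_siteMax : PT fun x : List ℕ × (List ℕ × List ℕ) => siteMax x.1 x.2.1 x.2.2 := by
  unfold siteMax
  fun_prop

theorem pt_siteMin : PT fun x : List ℕ × (List ℕ × List ℕ) => siteMin x.1 := by
  unfold siteMin
  fun_prop

/-- The maximality condition splits into conditions on the two sides of the site. -/
theorem siteMax_and_iff (x₁ u z v x₂ : List α) :
    (siteMax u.reverse z.reverse x₁.reverse = true ∧ siteMax v z x₂ = true) ↔
      u ≠ [] ∧ v ≠ [] ∧ ¬ ∃ x₁' x₂' z' : List α, x₁' <:+ x₁ ∧ x₂' <+: x₂ ∧ x₁' ++ x₂' ≠ [] ∧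
        u ++ z ++ v = x₁' ++ u ++ z' ++ v ++ x₂' := by
  rw [siteMax_iff, siteMax_iff, ne_eq, List.reverse_eq_nil_iff]
  constructor
  · rintro ⟨⟨hu, h1⟩, hv, h2⟩
    refine ⟨hu, hv, ?_⟩
    rintro ⟨x₁', x₂', z', hx₁, hx₂, hne, hy⟩
    -- Comparing lengths shows that `x₁'`, `z'` and `x₂'` together are as long as `z`. So `x₁' ++ u`
    -- fits into `u ++ z`, and `v ++ x₂'` into `z ++ v`.
    have hlen := congrArg List.length hy
    simp only [List.length_append] at hlen
    -- One nonempty extension suffices: if `x₂'` is nonempty, the right-hand condition fails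
    -- whatever `x₁'` is.
    rcases eq_or_ne x₂' [] with rfl | h
    · rw [List.append_nil] at hne hy
      refine h1 x₁'.reverse (by simpa using hne) (List.reverse_prefix.2 hx₁) ?_
      rw [← List.reverse_append, ← List.reverse_append, List.reverse_suffix]
      refine List.prefix_of_prefix_length_le (l₃ := u ++ z ++ v) ?_ (List.prefix_append _ _) ?_
      · exact ⟨z' ++ v, by simp [hy]⟩
      · simp only [List.length_append]
        omega
    · refine h2 x₂' h hx₂ ?_
      refine List.suffix_of_suffix_length_le (l₃ := u ++ z ++ v) ?_ ?_ ?_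
      · rw [hy, List.append_assoc]
        exact List.suffix_append _ _
      · rw [List.append_assoc]
        exact List.suffix_append _ _
      · simp only [List.length_append]
        omega
  · rintro ⟨hu, hv, h⟩
    refine ⟨⟨hu, fun t ht hts hs => h ?_⟩, hv, fun t ht hts hs => h ?_⟩
    · have hs' : t.reverse ++ u <+: u ++ z := by
        rw [← List.reverse_suffix]
        simpa using hs
      obtain ⟨z', hz⟩ := hs'
      -- A violation on the left is an extension with nothing added on the right.
      refine ⟨t.reverse, [], z', ?_, List.nil_prefix, by simpa using ht, ?_⟩
      · rw [← List.reverse_prefix, List.reverse_reverse]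
        exact hts
      · rw [← hz]
        simp
    · obtain ⟨z', hz⟩ := hs
      refine ⟨[], t, z', List.nil_suffix, hts, by simpa using ht, ?_⟩
      rw [List.append_assoc, ← hz]
      simp

theorem siteMin_reverse_iff {u : List α} : siteMin u.reverse = true ↔
    u ≠ [] ∧ ¬ ∃ s : List α, s ≠ [] ∧ s ≠ u ∧ s <:+ u ∧ s <+: u := by
  rw [siteMin_iff, ne_eq, List.reverse_eq_nil_iff]
  refine and_congr_right fun _ => not_congr ⟨?_, ?_⟩
  · rintro ⟨s, h1, h2, h3, h4⟩
    refine ⟨s.reverse, by simpa using h1, fun e => h2 (by rw [← e, List.reverse_reverse]), ?_, ?_⟩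
    · rwa [← List.reverse_prefix, List.reverse_reverse]
    · rwa [← List.reverse_suffix, List.reverse_reverse]
  · rintro ⟨s, h1, h2, h3, h4⟩
    exact ⟨s.reverse, by simpa using h1, fun e => h2 (List.reverse_injective e),
      List.reverse_prefix.2 h3, List.reverse_suffix.2 h4⟩

end

end StackProgram

/-! ### The two decision problems -/

open StackProgram in
theorem corollary2 :
    DecidableAndPolyTimeOnBoundedDFA (fun I => maxSDI I.R I.F ≤ I.R) ∧
    DecidableAndPolyTimeOnBoundedDFA (fun I => minSDI I.R I.F ≤ I.R) := by
  constructor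
  · refine decidableAndPolyTime_of_condition _ pt_siteMax (fun v z s => siteMax_take v z s) _
      fun I => ?_
    simp only [← List.map_reverse, siteMax_map Fin.val_injective]
    constructor
    · rintro h ⟨u, z, v, x₁, x₂, hw, hu, hv, hx, hx'⟩
      refine hx' (h ⟨_, hx, _, hw, x₁, u, z, v, x₂, by simp, by simp, rfl, ?_⟩)
      exact (siteMax_and_iff _ _ _ _ _).1 ⟨hu, hv⟩
    · rintro h w ⟨x, hx, y, hy, x₁, u, z, v, x₂, rfl, rfl, rfl, hs⟩
      by_contra hx''
      have hx' : x₁ ++ u ++ z ++ v ++ x₂ ∉ I.R := hx''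
      obtain ⟨hu, hv⟩ := (siteMax_and_iff _ _ _ _ _).2 hs
      exact h ⟨u, z, v, x₁, x₂, hy, hu, hv, by simpa using hx, by simpa using hx'⟩
  -- Minimality ignores the letters around the site, so the window plays no role.
  · refine decidableAndPolyTime_of_condition _ pt_siteMin (fun v z s => rfl) _ fun I => ?_
    simp only [← List.map_reverse, siteMin_map Fin.val_injective]
    constructor
    · rintro h ⟨u, z, v, x₁, x₂, hw, hu, hv, hx, hx'⟩
      have hu' := siteMin_reverse_iff.1 hu
      have hv' := siteMin_iff.1 hv
      exact hx' (h ⟨_, hx, _, hw, x₁, u, z, v, x₂, by simp, by simp, rfl, hu'.1, hv'.1, hu'.2,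
        hv'.2⟩)
    · rintro h w ⟨x, hx, y, hy, x₁, u, z, v, x₂, rfl, rfl, rfl, hu, hv, hu', hv'⟩
      by_contra hx''
      have hx' : x₁ ++ u ++ z ++ v ++ x₂ ∉ I.R := hx''
      exact h ⟨u, z, v, x₁, x₂, hy, siteMin_reverse_iff.2 ⟨hu, hu'⟩, siteMin_iff.2 ⟨hv, hv'⟩,
        by simpa using hx, by simpa using hx'⟩
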